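/- \textbf{Theorem (margin and generalization error bound for BoostResNet).} \emph{Network.} Let $n,m,T\in\mathbb N$, $m\ge 1$, let $\sigma:\mathbb R\to\mathbb R$ be $1$-Lipschitz with $\sigma(0)=0$, and let $\Lambda_{t,t-1}\ge 0$ $(t\ge 0)$. Define classes of functions $\mathbb R^n\to\mathbb R$ by $\mathcal F_0=\{x\mapsto u^\top x:\|u\|_1\le\Lambda_{0,-1}\}$ and $\mathcal F_t=\{x\mapsto\sum_{i=1}^n u_i\,\sigma(\psi_i(x)):\|u\|_1\le\Lambda_{t,t-1},\ \psi_1,\dots,\psi_n\in\mathcal F_{t-1}\}$ for $t\ge1$. For modules $f_t:\mathbb R^n\to\mathbb R^n$ put $g_0(x)=0$, $g_1(x)=f_0(x)$, $g_{t+1}(x)=f_t(g_t(x))+g_t(x)$ for $t\ge 1$ (module $0$ is the input layer and reads $x$). For $w_t\in\mathbb R^n$ let $o_t(x)=w_t^\top g_t(x)$ be the hypothesis modules, and let $F(x)=w_{T+1}^\top g_{T+1}(x)$ be the output of the depth-$T$ network. \emph{Algorithm.} Given a sample $S=(x_i,y_i)_{i\le m}$ with $x_i\in\mathbb R^n$,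 $y_i\in\{-1,1\}$, start with $\alpha_0=0$, $\tilde\gamma_0=0$, $D_0(i)=1/m$. In each round $t=0,\dots,T$ an oracle chooses $f_t,\alpha_{t+1}\in\mathbb R,w_{t+1}$ so that every coordinate of $x\mapsto f_t(g_t(x))$ (of $x\mapsto f_0(x)$ if $t=0$) belongs to $\mathcal F_t$, so that $|o_{t+1}(x_i)|\le1$ for all $i$, and so that, among all such choices, the loss $Z_t=\sum_i D_t(i)\exp(-y_ih_t(x_i))$, where $h_t=\alpha_{t+1}o_{t+1}-\alpha_to_t$, is minimal up to a fixed tolerance $\eta\ge0$ ($\eta=0$: exact minimization). Then $D_{t+1}(i)=D_t(i)e^{-y_ih_t(x_i)}/Z_t$ and $\tilde\gamma_{t+1}=\sum_iD_t(i)\,y_io_{t+1}(x_i)$. \emph{Weak learning condition with parameter $\gamma>0$.} $0<\tilde\gamma_{t+1}<1$ for $0\le t\le T$; and for $1\le t\le T$, $$\gamma_t^2:=\frac{\tilde\gamma_{t+1}^2-\tilde\gamma_t^2}{1-\tilde\gamma_t^2}\ \ge\ \gamma^2,$$ and the covariance under $D_t$ (over $i$) between $\exp(-a_{t+1}\,y_io_{t+1}(x_i))$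 and $\exp(\alpha_t\,y_io_t(x_i))$ is non-positive, where $a_{t+1}=\frac12\ln\frac{1+\tilde\gamma_{t+1}}{1-\tilde\gamma_{t+1}}$. \emph{(1) Margins.} For every sample $S$, every run of the algorithm on $S$ that satisfies the weak learning condition, and every $\theta\in\mathbb R$, the fraction of training examples with margin $y_iF(x_i)\le\theta$ is at most $$B:=\Bigl(1+\frac{2}{1/\tilde\gamma_{T+1}-1}\Bigr)^{\theta/2}\exp\bigl(-\tfrac12\gamma^2T\bigr).$$ \emph{(2) Generalization.} Let $T\ge2$, let $D$ be a probability distribution on $\mathbb R^n\times\{-1,1\}$, let $S$ consist of $m$ independent draws from $D$, and suppose $r_\infty:=\mathbb E_S[\max_{i\le m}\|x_i\|_\infty]<\infty$. Let $C_0\in\mathbb R$, $\theta>0$, $0<\delta<1$. Then, with probability at least $1-\delta$ over $S$, every run of the algorithm on $S$ that satisfies the weak learning condition and $\|w_{T+1}\|_1\le C_0$ has $$\Pr_D\bigl(yF(x)\le0\bigr)\ \le\ B+\frac{4C_0r_\infty}{\theta}\sqrt{\frac{\log(2n)}{2m}}\sum_{t=0}^T\Lambda_t+\frac2\theta\sqrt{\frac{\log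 T}{m}}+\beta(\theta,m,T,\delta),$$ where $\Lambda_t=\prod_{s=0}^t2\Lambda_{s,s-1}$ and $$\beta(\theta,m,T,\delta)=\sqrt{\Bigl\lceil\frac4{\theta^2}\log\frac{\theta^2m}{\log T}\Bigr\rceil\frac{\log T}{m}+\frac{\log(2/\delta)}{2m}}$$ (a negative radicand, which can occur only when the bound is trivial, is replaced by $0$). -/

import Mathlib

open MeasureTheory

noncomputable section

namespace BoostResNet

/-- A feature vector with `n` channels; its norm is the sup norm. -/
abbrev Vec (n : ℕ) : Type := Fin n → ℝ

/-- A training sample: `m` pairs (input, label), with labels in `{-1, 1}`. -/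
abbrev Sample (n m : ℕ) : Type := Fin m → Vec n × ℝ

/-- The ℓ¹ norm of a weight vector. -/
def l1norm {n : ℕ} (u : Vec n) : ℝ := ∑ j, |u j|

/-! ### The residual network -/

/-- The representation `g t x`: `g 0 x = 0`, and `g (t+1) x = f t (input) + g t x`, where the input
of module `t` is `g t x`, except that module `0` is the input layer and reads `x` itself. -/
def repr {n : ℕ} (f : ℕ → Vec n → Vec n) (x : Vec n) : ℕ → Vec n
  | 0 => 0
  | t + 1 => f t (if t = 0 then x else repr f x t) + repr f x t

/-- The vector that module `t` reads when the network is applied to `x`. -/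
def moduleInput {n : ℕ} (f : ℕ → Vec n → Vec n) (x : Vec n) (t : ℕ) : Vec n :=
  if t = 0 then x else repr f x t

/-- The hypothesis module `o t x = ⟨w t, g t x⟩`. -/
def hypModule {n : ℕ} (f : ℕ → Vec n → Vec n) (w : ℕ → Vec n) (t : ℕ) (x : Vec n) : ℝ :=
  ∑ j, w t j * repr f x t j

/-- The weak module classifier `h t x = α (t+1) * o (t+1) x - α t * o t x`. -/
def weakModule {n : ℕ} (f : ℕ → Vec n → Vec n) (w : ℕ → Vec n) (α : ℕ → ℝ) (t : ℕ)
    (x : Vec n) : ℝ :=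
  α (t + 1) * hypModule f w (t + 1) x - α t * hypModule f w t x

/-- The output `F x = ⟨w (T+1), g (T+1) x⟩` of the depth-`T` residual network. -/
def network {n : ℕ} (f : ℕ → Vec n → Vec n) (w : ℕ → Vec n) (T : ℕ) (x : Vec n) : ℝ :=
  hypModule f w (T + 1) x

/-- The neuron classes: `𝓕 0` consists of the linear functions `x ↦ ⟨u, x⟩`, `‖u‖₁ ≤ Λ 0`, and
`𝓕 (t+1)` of the functions `x ↦ ∑ i, u i * σ (ψ i x)` with `‖u‖₁ ≤ Λ (t+1)`, `ψ i ∈ 𝓕 t`.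
Here `Λ t` is the bound for the weights between layer `t` and layer `t - 1`. -/
def neuronClass {n : ℕ} (σ : ℝ → ℝ) (Λ : ℕ → ℝ) : ℕ → Set (Vec n → ℝ)
  | 0 => {φ | ∃ u : Vec n, l1norm u ≤ Λ 0 ∧ φ = fun x => ∑ i, u i * x i}
  | t + 1 => {φ | ∃ (u : Vec n) (ψ : Fin n → Vec n → ℝ), l1norm u ≤ Λ (t + 1) ∧
      (∀ i, ψ i ∈ neuronClass σ Λ t) ∧ φ = fun x => ∑ i, u i * σ (ψ i x)}

/-! ### The boosting algorithm -/

/-- The weights of the examples: uniform at the start, then multiplied by `exp (-y * h t x)` and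
normalized. -/
def weight {n m : ℕ} (S : Sample n m) (f : ℕ → Vec n → Vec n) (w : ℕ → Vec n) (α : ℕ → ℝ) :
    ℕ → Fin m → ℝ
  | 0 => fun _ => 1 / (m : ℝ)
  | t + 1 => fun i =>
      weight S f w α t i * Real.exp (-((S i).2 * weakModule f w α t (S i).1)) /
        ∑ k, weight S f w α t k * Real.exp (-((S k).2 * weakModule f w α t (S k).1))

/-- Expectation over the examples under the weights of round `t`. -/
def wexp {n m : ℕ} (S : Sample n m) (f : ℕ → Vec n → Vec n) (w : ℕ → Vec n) (α : ℕ → ℝ) (t : ℕ)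
    (X : Fin m → ℝ) : ℝ :=
  ∑ i, weight S f w α t i * X i

/-- Covariance over the examples under the weights of round `t`. -/
def wcov {n m : ℕ} (S : Sample n m) (f : ℕ → Vec n → Vec n) (w : ℕ → Vec n) (α : ℕ → ℝ) (t : ℕ)
    (X Y : Fin m → ℝ) : ℝ :=
  wexp S f w α t (fun i => X i * Y i) - wexp S f w α t X * wexp S f w α t Y

/-- The edge of the hypothesis module `o t`: its correlation with the labels under the weights of
round `t - 1`; the edge of `o 0 = 0` is `0`. -/
def edge {n m : ℕ} (S : Sample n m) (f : ℕ → Vec n → Vec n) (w : ℕ → Vec n) (α : ℕ → ℝ) : ℕ → ℝ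
  | 0 => 0
  | t + 1 => wexp S f w α t (fun i => (S i).2 * hypModule f w (t + 1) (S i).1)

/-- The coefficient `(1/2) log ((1 + e) / (1 - e))` that belongs to the edge `e`. -/
def edgeCoeff (e : ℝ) : ℝ := (1 / 2) * Real.log ((1 + e) / (1 - e))

/-- The search space of the oracle at round `t`: pairs of a module `φ` whose neurons, as functions
of the input of the network, belong to `𝓕 t`, and a linear classifier `v` for which the resulting
hypothesis module is bounded by `1` on the sample. -/
def Feasible {n m : ℕ} (σ : ℝ → ℝ) (Λ : ℕ → ℝ) (S : Sample n m) (f : ℕ → Vec n → Vec n) (t : ℕ)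
    (φ : Vec n → Vec n) (v : Vec n) : Prop :=
  (∀ j, (fun x => φ (moduleInput f x t) j) ∈ neuronClass σ Λ t) ∧
    ∀ i, |∑ j, v j * (φ (moduleInput f (S i).1 t) + repr f (S i).1 t) j| ≤ 1

/-- The exponential loss `Z t` at round `t`, as a function of the new module `φ`, the new
coefficient `a` and the new classifier `v`. -/
def objective {n m : ℕ} (S : Sample n m) (f : ℕ → Vec n → Vec n) (w : ℕ → Vec n) (α : ℕ → ℝ)
    (t : ℕ) (φ : Vec n → Vec n) (a : ℝ) (v : Vec n) : ℝ :=
  wexp S f w α t fun i =>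
    Real.exp (-((S i).2 * (a * ∑ j, v j * (φ (moduleInput f (S i).1 t) + repr f (S i).1 t) j))
      + (S i).2 * (α t * hypModule f w t (S i).1))

/-- `(f, w, α)` is produced by rounds `0, …, T` of the algorithm on the sample `S`: at every round
the oracle returns a minimizer, up to `η`, of the exponential loss over its search space.
The exact algorithm is `η = 0`. -/
structure IsRun {n m : ℕ} (σ : ℝ → ℝ) (Λ : ℕ → ℝ) (η : ℝ) (T : ℕ) (S : Sample n m)
    (f : ℕ → Vec n → Vec n) (w : ℕ → Vec n) (α : ℕ → ℝ) : Prop where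
  alpha_zero : α 0 = 0
  feasible : ∀ t ≤ T, Feasible σ Λ S f t (f t) (w (t + 1))
  oracle : ∀ t ≤ T, ∀ (φ : Vec n → Vec n) (a : ℝ) (v : Vec n), Feasible σ Λ S f t φ v →
    objective S f w α t (f t) (α (t + 1)) (w (t + 1)) ≤ objective S f w α t φ a v + η

/-- The `γ`-weak learning condition for the modules up to depth `T`: the edges of
`o 1, …, o (T+1)` lie strictly between `0` and `1`; and for `t = 1, …, T` the normalized
improvement of the squared edge is at least `γ ^ 2`, and the two exponential factors of the new
and of the old hypothesis module have non-positive covariance under the weights of round `t`. -/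
structure WeakLearning {n m : ℕ} (γ : ℝ) (T : ℕ) (S : Sample n m)
    (f : ℕ → Vec n → Vec n) (w : ℕ → Vec n) (α : ℕ → ℝ) : Prop where
  edge_mem : ∀ t ≤ T, edge S f w α (t + 1) ∈ Set.Ioo (0 : ℝ) 1
  improvement : ∀ t, 1 ≤ t → t ≤ T →
    γ ^ 2 ≤ (edge S f w α (t + 1) ^ 2 - edge S f w α t ^ 2) / (1 - edge S f w α t ^ 2)
  cov_nonpos : ∀ t, 1 ≤ t → t ≤ T →
    wcov S f w α t
      (fun i => Real.exp (-(edgeCoeff (edge S f w α (t + 1)) *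
        ((S i).2 * hypModule f w (t + 1) (S i).1))))
      (fun i => Real.exp (α t * ((S i).2 * hypModule f w t (S i).1))) ≤ 0

/-! ### The quantities in the bounds -/

/-- The fraction of training examples with margin `y * F x` at most `θ`. -/
def marginFraction {n m : ℕ} (S : Sample n m) (F : Vec n → ℝ) (θ : ℝ) : ℝ :=
  ({i : Fin m | (S i).2 * F (S i).1 ≤ θ}.ncard : ℝ) / m

/-- The margin bound, with `e` the edge of the last hypothesis module. -/
def marginBound (γ : ℝ) (T : ℕ) (e θ : ℝ) : ℝ :=
  (1 + 2 / (1 / e - 1)) ^ (θ / 2) * Real.exp (-(1 / 2) * γ ^ 2 * T)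

/-- The law of `m` independent draws from `D`. -/
def sampleLaw {n : ℕ} (m : ℕ) (D : Measure (Vec n × ℝ)) : Measure (Sample n m) :=
  Measure.pi fun _ => D

/-- The largest sup norm of an input in the sample. -/
def maxInput {n m : ℕ} (S : Sample n m) : ℝ := ⨆ i, ‖(S i).1‖

/-- `r∞ = E_S [max_i ‖x_i‖_∞]`. -/
def rInf {n : ℕ} (m : ℕ) (D : Measure (Vec n × ℝ)) : ℝ := ∫ S, maxInput S ∂(sampleLaw m D)

/-- `Λ_t = ∏_{s=0}^{t} 2 Λ_{s,s-1}`. -/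
def weightProd (Λ : ℕ → ℝ) (t : ℕ) : ℝ := ∏ s ∈ Finset.range (t + 1), 2 * Λ s

/-- The confidence term `β(θ, m, T, δ)`. -/
def betaTerm (θ : ℝ) (m T : ℕ) (δ : ℝ) : ℝ :=
  √((⌈4 / θ ^ 2 * Real.log (θ ^ 2 * m / Real.log T)⌉ : ℝ) * (Real.log T / m)
    + Real.log (2 / δ) / (2 * m))

end BoostResNet

end

namespace BoostResNet

/-! ### Margins on the training sample -/

/-! Margins. Since `h t` is a difference of consecutive terms, the updates telescope: the weights of
round `t` are proportional to `exp (-α t * y * o t)` (`weight_eq_gibbs`). Hence the factor `exp (α T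
* y * o T)` in the covariance condition turns these weights into a constant, and non-positive
covariance bounds the uniform average of `exp (-a * y * o (T+1))`, with `a` the coefficient of the
last edge `e`, by its average under the weights of round `T`. Convexity bounds the latter by `√(1 -
e²)` (`sum_mul_exp_edgeCoeff_le`). The improvement condition says that `1 - e²` shrinks by a factor
`1 - γ²` per round (`one_sub_edge_sq_le`), and Markov's inequality converts the exponential average
into a fraction of margins.

Generalization. The ramp loss lies between the indicator of an error and the indicator of a margin
at most `θ`, so it suffices to control its expectation minus its empirical mean uniformly over a
class containing every network a run can output. McDiarmid's inequality reduces this to the mean of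
the supremum, and symmetrization (`integral_supDev_le_ghostDev`, `integral_ghostDev_le`) reduces the
mean to Rademacher sums. The contraction principle (`RadBound.contract`) removes the ramp and the
activations, `RadBound.linearCombination` pays twice the `ℓ¹` bound per layer, and Massart's bound
treats the input coordinates. A network is a sum of its layers composed with one linear classifier,
so the complexities of the layers add up.

Suprema over the uncountable class are never measured: Rademacher bounds are stated through
selections, and the deviation event is reduced to a countable dense family, then to finite families.
-/

theorem weight_eq_gibbs {n m : ℕ} (S : Sample n m) (f : ℕ → Vec n → Vec n) (w : ℕ → Vec n)
    (α : ℕ → ℝ) (hm : 0 < m) (hα : α 0 = 0) (t : ℕ) (i : Fin m) :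
    weight S f w α t i = Real.exp (-(α t * ((S i).2 * hypModule f w t (S i).1))) /
      ∑ k, Real.exp (-(α t * ((S k).2 * hypModule f w t (S k).1))) := by
  have : Nonempty (Fin m) := ⟨⟨0, hm⟩⟩
  induction t generalizing i with
  | zero => simp [weight, hα]
  | succ t ih =>
    have hN : 0 < ∑ k, Real.exp (-(α t * ((S k).2 * hypModule f w t (S k).1))) :=
      Finset.sum_pos (fun _ _ => Real.exp_pos _) Finset.univ_nonempty
    have key : ∀ k, weight S f w α t k * Real.exp (-((S k).2 * weakModule f w α t (S k).1)) =
        Real.exp (-(α (t + 1) * ((S k).2 * hypModule f w (t + 1) (S k).1))) /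
          ∑ k, Real.exp (-(α t * ((S k).2 * hypModule f w t (S k).1))) := by
      intro k
      rw [ih k, div_mul_eq_mul_div, ← Real.exp_add]
      congr 2
      simp only [weakModule]
      ring
    simp only [weight, key]
    rw [← Finset.sum_div]
    field_simp

theorem weight_nonneg {n m : ℕ} (S : Sample n m) (f : ℕ → Vec n → Vec n) (w : ℕ → Vec n)
    (α : ℕ → ℝ) (hm : 0 < m) (hα : α 0 = 0) (t : ℕ) (i : Fin m) : 0 ≤ weight S f w α t i := by
  rw [weight_eq_gibbs S f w α hm hα]
  positivity

theorem sum_weight {n m : ℕ} (S : Sample n m) (f : ℕ → Vec n → Vec n) (w : ℕ → Vec n)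
    (α : ℕ → ℝ) (hm : 0 < m) (hα : α 0 = 0) (t : ℕ) : ∑ i, weight S f w α t i = 1 := by
  have : Nonempty (Fin m) := ⟨⟨0, hm⟩⟩
  simp only [weight_eq_gibbs S f w α hm hα]
  rw [← Finset.sum_div, div_self]
  exact (Finset.sum_pos (fun _ _ => Real.exp_pos _) Finset.univ_nonempty).ne'

theorem exp_edgeCoeff {e : ℝ} (he : e ∈ Set.Ioo (0 : ℝ) 1) :
    Real.exp (edgeCoeff e) = √((1 + e) / (1 - e)) := by
  have h1 : 0 < 1 - e := by linarith [he.2]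
  have h2 : 0 < 1 + e := by linarith [he.1]
  have : edgeCoeff e = Real.log (√((1 + e) / (1 - e))) := by
    rw [Real.log_sqrt (by positivity), edgeCoeff]; ring
  rw [this, Real.exp_log (by positivity)]

theorem edgeCoeff_nonneg {e : ℝ} (he : e ∈ Set.Ioo (0 : ℝ) 1) : 0 ≤ edgeCoeff e := by
  have h1 : 0 < 1 - e := by linarith [he.2]
  refine mul_nonneg (by norm_num) (Real.log_nonneg ?_)
  rw [le_div_iff₀ h1]
  linarith [he.1]

/-- Convexity: on `[-1, 1]` the graph of the exponential lies below its chord. -/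
theorem exp_neg_mul_le_chord (a : ℝ) {q : ℝ} (hq : |q| ≤ 1) :
    Real.exp (-(a * q)) ≤ (1 + q) / 2 * Real.exp (-a) + (1 - q) / 2 * Real.exp a := by
  obtain ⟨h1, h2⟩ := abs_le.1 hq
  have := convexOn_exp.2 (Set.mem_univ (-a)) (Set.mem_univ a)
    (show 0 ≤ (1 + q) / 2 by linarith) (show 0 ≤ (1 - q) / 2 by linarith) (by ring)
  rwa [smul_eq_mul, smul_eq_mul, show (1 + q) / 2 * -a + (1 - q) / 2 * a = -(a * q) by ring]
    at this

/-- A classifier with edge `e` has exponential loss at most `√(1 - e²)` for the coefficient that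
belongs to its edge. -/
theorem sum_mul_exp_edgeCoeff_le {m : ℕ} (d q : Fin m → ℝ) (hd : ∀ i, 0 ≤ d i)
    (hd1 : ∑ i, d i = 1) (hq : ∀ i, |q i| ≤ 1) {e : ℝ} (he : e ∈ Set.Ioo (0 : ℝ) 1)
    (hdq : ∑ i, d i * q i = e) :
    ∑ i, d i * Real.exp (-(edgeCoeff e * q i)) ≤ √(1 - e ^ 2) := by
  set a := edgeCoeff e
  have h1 : 0 < 1 - e := by linarith [he.2]
  have h2 : 0 < 1 + e := by linarith [he.1]
  calc ∑ i, d i * Real.exp (-(a * q i))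
      ≤ ∑ i, d i * ((1 + q i) / 2 * Real.exp (-a) + (1 - q i) / 2 * Real.exp a) :=
        Finset.sum_le_sum fun i _ =>
          mul_le_mul_of_nonneg_left (exp_neg_mul_le_chord a (hq i)) (hd i)
    _ = (∑ i, d i + ∑ i, d i * q i) / 2 * Real.exp (-a)
        + (∑ i, d i - ∑ i, d i * q i) / 2 * Real.exp a := by
        simp only [← Finset.sum_add_distrib, ← Finset.sum_sub_distrib, Finset.sum_div,
          Finset.sum_mul]
        exact Finset.sum_congr rfl fun i _ => by ring
    _ = √(1 - e ^ 2) := by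
        rw [hd1, hdq, Real.exp_neg, exp_edgeCoeff he, Real.sqrt_div h2.le,
          show 1 - e ^ 2 = (1 + e) * (1 - e) by ring, Real.sqrt_mul h2.le]
        have s1 := Real.sq_sqrt h1.le
        have s2 := Real.sq_sqrt h2.le
        have p1 := Real.sqrt_pos.2 h1
        have p2 := Real.sqrt_pos.2 h2
        field_simp
        rw [s1, s2]
        ring

/-- The covariance condition transfers the estimate from the weights of round `T` to the uniform
weights. It is needed in round `T` alone, and no product of the losses of the rounds enters. -/
theorem sum_exp_margin_le {n m : ℕ} (hm : 0 < m) {T : ℕ} {σ : ℝ → ℝ} {Λ : ℕ → ℝ} {η γ : ℝ}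
    {S : Sample n m} (hS : ∀ i, (S i).2 = 1 ∨ (S i).2 = -1)
    {f : ℕ → Vec n → Vec n} {w : ℕ → Vec n} {α : ℕ → ℝ}
    (hr : IsRun σ Λ η T S f w α) (hw : WeakLearning γ T S f w α) :
    ∑ i, Real.exp (-(edgeCoeff (edge S f w α (T + 1)) *
      ((S i).2 * hypModule f w (T + 1) (S i).1))) ≤ m * √(1 - edge S f w α (T + 1) ^ 2) := by
  have hm' : (0 : ℝ) < m := by exact_mod_cast hm
  have : Nonempty (Fin m) := ⟨⟨0, hm⟩⟩
  have hq : ∀ i, |(S i).2 * hypModule f w (T + 1) (S i).1| ≤ 1 := by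
    intro i
    have h1 : |(S i).2| = 1 := by rcases hS i with h | h <;> simp [h]
    rw [abs_mul, h1, one_mul]
    exact (hr.feasible T le_rfl).2 i
  have hchord := sum_mul_exp_edgeCoeff_le (weight S f w α T) _
    (weight_nonneg S f w α hm hr.alpha_zero T) (sum_weight S f w α hm hr.alpha_zero T) hq
    (hw.edge_mem T le_rfl) rfl
  rcases Nat.eq_zero_or_pos T with rfl | hT
  -- In round `0` the weights are already uniform, so no covariance condition is required.
  · simp only [weight, ← Finset.mul_sum] at hchord
    rwa [one_div, inv_mul_le_iff₀ hm'] at hchord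
  · have hcov := hw.cov_nonpos T hT le_rfl
    set a := edgeCoeff (edge S f w α (T + 1))
    set N := ∑ k, Real.exp (-(α T * ((S k).2 * hypModule f w T (S k).1))) with hNdef
    have hN : 0 < N := Finset.sum_pos (fun _ _ => Real.exp_pos _) Finset.univ_nonempty
    -- The second factor of the covariance is exactly the inverse of the unnormalized Gibbs weight.
    have hcancel : ∀ i, weight S f w α T i *
        Real.exp (α T * ((S i).2 * hypModule f w T (S i).1)) = 1 / N := by
      intro i
      rw [weight_eq_gibbs S f w α hm hr.alpha_zero, div_mul_eq_mul_div, ← Real.exp_add]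
      simp [hNdef]
    have e1 : wexp S f w α T (fun i => Real.exp (α T * ((S i).2 * hypModule f w T (S i).1)))
        = m / N := by
      simp only [wexp, hcancel]
      simp [div_eq_mul_inv]
    have e2 : wexp S f w α T (fun i =>
        Real.exp (-(a * ((S i).2 * hypModule f w (T + 1) (S i).1))) *
          Real.exp (α T * ((S i).2 * hypModule f w T (S i).1)))
        = (∑ i, Real.exp (-(a * ((S i).2 * hypModule f w (T + 1) (S i).1)))) / N := by
      simp only [wexp, Finset.sum_div]
      refine Finset.sum_congr rfl fun i _ => ?_
      rw [mul_left_comm, hcancel]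
      ring
    rw [wcov, e1, e2, sub_nonpos, mul_div_assoc', div_le_div_iff_of_pos_right hN] at hcov
    refine hcov.trans ?_
    rw [mul_comm]
    exact mul_le_mul_of_nonneg_left hchord hm'.le

/-- The improvement condition rearranges to `1 - e'² ≤ (1 - γ²) (1 - e²)` for consecutive edges. The
shift of the index reflects that the first edge need only satisfy the trivial bound `1`. -/
theorem one_sub_edge_sq_le {n m : ℕ} {T : ℕ} {γ : ℝ} {S : Sample n m}
    {f : ℕ → Vec n → Vec n} {w : ℕ → Vec n} {α : ℕ → ℝ}
    (hw : WeakLearning γ T S f w α) :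
    ∀ t ≤ T, 1 - edge S f w α (t + 1) ^ 2 ≤ Real.exp (-(γ ^ 2 * t)) := by
  intro t
  induction t with
  | zero => intro _; simp; positivity
  | succ t ih =>
    intro ht
    have hi := hw.improvement (t + 1) (by omega) ht
    have he := hw.edge_mem t (by omega)
    have ih := ih (by omega)
    set e := edge S f w α (t + 1)
    set e' := edge S f w α (t + 1 + 1)
    have hp : 0 < 1 - e ^ 2 := by nlinarith [he.1, he.2]
    rw [le_div_iff₀ hp] at hi
    have h1 : 1 - γ ^ 2 ≤ Real.exp (-γ ^ 2) := by
      linarith [Real.add_one_le_exp (-γ ^ 2)]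
    calc 1 - e' ^ 2 ≤ (1 - γ ^ 2) * (1 - e ^ 2) := by linarith
      _ ≤ Real.exp (-γ ^ 2) * (1 - e ^ 2) := mul_le_mul_of_nonneg_right h1 hp.le
      _ ≤ Real.exp (-γ ^ 2) * Real.exp (-(γ ^ 2 * t)) :=
        mul_le_mul_of_nonneg_left ih (Real.exp_pos _).le
      _ = Real.exp (-(γ ^ 2 * (t + 1 : ℕ))) := by
        rw [← Real.exp_add]; congr 1; push_cast; ring

/-- Markov's inequality for the exponential: each counted index contributes at least `1` on the
right. -/
theorem ncard_margin_le_sum_exp {m : ℕ} (q : Fin m → ℝ) {a : ℝ} (ha : 0 ≤ a) (θ : ℝ) :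
    ({i | q i ≤ θ}.ncard : ℝ) ≤ Real.exp (a * θ) * ∑ i, Real.exp (-(a * q i)) := by
  classical
  have h : {i | q i ≤ θ} = ((Finset.univ.filter fun i => q i ≤ θ : Finset (Fin m)) : Set _) := by
    ext; simp
  rw [h, Set.ncard_coe_finset, Finset.card_filter, Finset.mul_sum]
  push_cast
  refine Finset.sum_le_sum fun i _ => ?_
  rw [← Real.exp_add]
  split_ifs with hi
  · refine Real.one_le_exp ?_
    nlinarith
  · positivity

theorem marginFraction_le_marginBound {n m : ℕ} (hm : 0 < m) {T : ℕ} {σ : ℝ → ℝ} {Λ : ℕ → ℝ}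
    {η γ : ℝ} {S : Sample n m} (hS : ∀ i, (S i).2 = 1 ∨ (S i).2 = -1)
    {f : ℕ → Vec n → Vec n} {w : ℕ → Vec n} {α : ℕ → ℝ}
    (hr : IsRun σ Λ η T S f w α) (hw : WeakLearning γ T S f w α) (θ : ℝ) :
    marginFraction S (network f w T) θ ≤ marginBound γ T (edge S f w α (T + 1)) θ := by
  have hm' : (0 : ℝ) < m := by exact_mod_cast hm
  have he := hw.edge_mem T le_rfl
  have hsum := sum_exp_margin_le hm hS hr hw
  have hedge := one_sub_edge_sq_le hw T le_rfl
  set e := edge S f w α (T + 1)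
  have h1 : 0 < 1 - e := by linarith [he.2]
  have h2 : 0 < 1 + e := by linarith [he.1]
  have hbase : 1 + 2 / (1 / e - 1) = (1 + e) / (1 - e) := by
    have := he.1.ne'
    have : 1 / e - 1 = (1 - e) / e := by field_simp
    rw [this]
    field_simp
    ring
  have hpow : (1 + 2 / (1 / e - 1)) ^ (θ / 2) = Real.exp (edgeCoeff e * θ) := by
    rw [hbase, Real.rpow_def_of_pos (by positivity), edgeCoeff]
    congr 1
    ring
  have hsqrt : √(1 - e ^ 2) ≤ Real.exp (-(1 / 2) * γ ^ 2 * T) := by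
    refine Real.sqrt_le_iff.2 ⟨by positivity, hedge.trans_eq ?_⟩
    rw [← Real.exp_nat_mul]
    congr 1
    push_cast
    ring
  rw [marginFraction, marginBound, hpow, div_le_iff₀ hm']
  refine (ncard_margin_le_sum_exp _ (edgeCoeff_nonneg he) θ).trans ?_
  rw [mul_assoc]
  refine mul_le_mul_of_nonneg_left (hsum.trans ?_) (by positivity)
  rw [mul_comm]
  exact mul_le_mul_of_nonneg_right hsqrt hm'.le

/-! ### Rademacher sums -/

/-- The sign `1` or `-1` encoded by a Boolean. -/
def sgn (b : Bool) : ℝ := cond b 1 (-1)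

/-- The signed sum `∑ i, ± v i`. -/
def signedSum {m : ℕ} (ε : Fin m → Bool) (v : Fin m → ℝ) : ℝ := ∑ i, sgn (ε i) * v i

/-- The sum over all sign patterns `ε` of the supremum over `a` of the signed sum of `v a` is at
most `c`; expressed by selections of one index for each sign pattern. -/
def RadBound {ι : Type*} {m : ℕ} (v : ι → Fin m → ℝ) (c : ℝ) : Prop :=
  ∀ s : (Fin m → Bool) → ι, ∑ ε, signedSum ε (v (s ε)) ≤ c

theorem RadBound.comp {ι κ : Type*} {m : ℕ} {v : ι → Fin m → ℝ} {c : ℝ} (h : RadBound v c)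
    (g : κ → ι) : RadBound (fun a => v (g a)) c := fun s => h fun ε => g (s ε)

theorem RadBound.const_mul {ι : Type*} {m : ℕ} {v : ι → Fin m → ℝ} {c : ℝ} (h : RadBound v c)
    {b : ℝ} (hb : 0 ≤ b) : RadBound (fun a i => b * v a i) (b * c) := by
  intro s
  have : ∑ ε, signedSum ε (fun i => b * v (s ε) i) = b * ∑ ε, signedSum ε (v (s ε)) := by
    simp only [signedSum, Finset.mul_sum]
    exact Finset.sum_congr rfl fun _ _ => Finset.sum_congr rfl fun _ _ => by ring
  rw [this]
  exact mul_le_mul_of_nonneg_left (h s) hb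

theorem RadBound.sum {ι κ : Type*} {m : ℕ} (A : Finset κ) {v : κ → ι → Fin m → ℝ} {c : κ → ℝ}
    (h : ∀ k ∈ A, RadBound (v k) (c k)) :
    RadBound (fun a i => ∑ k ∈ A, v k a i) (∑ k ∈ A, c k) := by
  intro s
  have : ∑ ε, signedSum ε (fun i => ∑ k ∈ A, v k (s ε) i)
      = ∑ k ∈ A, ∑ ε, signedSum ε (v k (s ε)) := by
    rw [Finset.sum_comm]
    refine Finset.sum_congr rfl fun ε _ => ?_
    simp only [signedSum, Finset.mul_sum]
    exact Finset.sum_comm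
  rw [this]
  exact Finset.sum_le_sum fun k hk => h k hk s

theorem RadBound.nonneg {ι : Type*} {m : ℕ} {v : ι → Fin m → ℝ} {c : ℝ} (h : RadBound v c)
    {a : ι} (ha : v a = 0) : 0 ≤ c := by
  have := h fun _ => a
  simpa [ha, signedSum] using this

/-- Reversal of the sign with index `k`. -/
def flipSign {m : ℕ} (k : Fin m) (ε : Fin m → Bool) : Fin m → Bool :=
  Function.update ε k (!ε k)

theorem flipSign_flipSign {m : ℕ} (k : Fin m) (ε : Fin m → Bool) :
    flipSign k (flipSign k ε) = ε := by simp [flipSign]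

theorem sum_flipSign {m : ℕ} (k : Fin m) (G : (Fin m → Bool) → ℝ) :
    ∑ ε, G (flipSign k ε) = ∑ ε, G ε :=
  Equiv.sum_comp (Function.Involutive.toPerm _ (flipSign_flipSign k)) G

/-- Pair each sign pattern with its flip at `k`. Within a pair, coordinate `k` enters only through
the difference of its values at the two selected indices; replacing `v'` by `v` does not decrease
the absolute value of this difference, and exchanging the two selections makes it non-negative
without affecting the other coordinates. -/
theorem RadBound.contract_coord {ι : Type*} {m : ℕ} {v v' : ι → Fin m → ℝ} {c : ℝ}
    (h : RadBound v c) (k : Fin m) (hne : ∀ a, ∀ i ≠ k, v' a i = v a i)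
    (hk : ∀ a b, |v' a k - v' b k| ≤ |v a k - v b k|) : RadBound v' c := by
  classical
  intro s
  let R : (Fin m → Bool) → (Fin m → ℝ) → ℝ := fun ε u =>
    ∑ i ∈ Finset.univ.erase k, sgn (ε i) * u i
  have hsplit : ∀ ε u, signedSum ε u = sgn (ε k) * u k + R ε u := fun ε u =>
    (Finset.add_sum_erase _ _ (Finset.mem_univ k)).symm
  have hR : ∀ ε a, R ε (v' a) = R ε (v a) := fun ε a =>
    Finset.sum_congr rfl fun i hi => by rw [hne a i (Finset.ne_of_mem_erase hi)]
  have hRf : ∀ ε u, R (flipSign k ε) u = R ε u := fun ε u =>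
    Finset.sum_congr rfl fun i hi => by
      rw [flipSign, Function.update_of_ne (Finset.ne_of_mem_erase hi)]
  have hfk : ∀ ε, flipSign k ε k = !ε k := fun ε => by simp [flipSign]
  -- The comparison depends only on the pair `{ε, flipSign k ε}`, so both members agree on whether
  -- to exchange their selections.
  let b : (Fin m → Bool) → ι := fun ε =>
    if v (s (Function.update ε k false)) k ≤ v (s (Function.update ε k true)) k
    then s ε else s (flipSign k ε)
  have htrue : ∀ ε, ε k = true →
      signedSum ε (v' (s ε)) + signedSum (flipSign k ε) (v' (s (flipSign k ε))) ≤
      signedSum ε (v (b ε)) + signedSum (flipSign k ε) (v (b (flipSign k ε))) := by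
    intro ε hε
    have e1 : Function.update ε k true = ε := by rw [← hε]; simp
    have e2 : Function.update ε k false = flipSign k ε := by simp [flipSign, hε]
    have e3 : ∀ c, Function.update (flipSign k ε) k c = Function.update ε k c := by
      intro c; simp [flipSign]
    have hb := (le_abs_self _).trans (hk (s ε) (s (flipSign k ε)))
    simp only [b, e3, e1, e2, flipSign_flipSign]
    simp only [hsplit, hR, hRf, hfk, hε, Bool.not_true, sgn, cond_true, cond_false]
    split_ifs with hle
    · rw [abs_of_nonneg (by linarith)] at hb
      linarith
    · rw [abs_of_neg (by linarith)] at hb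
      linarith
  have hpair : ∀ ε,
      signedSum ε (v' (s ε)) + signedSum (flipSign k ε) (v' (s (flipSign k ε))) ≤
      signedSum ε (v (b ε)) + signedSum (flipSign k ε) (v (b (flipSign k ε))) := by
    intro ε
    cases hε : ε k with
    | true => exact htrue ε hε
    | false =>
      have := htrue (flipSign k ε) (by rw [hfk, hε]; rfl)
      rw [flipSign_flipSign] at this
      linarith
  have h2 := Finset.sum_le_sum fun ε (_ : ε ∈ Finset.univ) => hpair ε
  simp only [Finset.sum_add_distrib] at h2
  rw [sum_flipSign k fun ε => signedSum ε (v' (s ε)),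
    sum_flipSign k fun ε => signedSum ε (v (b ε))] at h2
  have := h b
  linarith

/-- The contraction principle. -/
theorem RadBound.contract {ι : Type*} {m : ℕ} {v v' : ι → Fin m → ℝ} {c : ℝ}
    (h : RadBound v c) (hk : ∀ a b i, |v' a i - v' b i| ≤ |v a i - v b i|) : RadBound v' c := by
  classical
  have : ∀ A : Finset (Fin m), RadBound (fun a i => if i ∈ A then v' a i else v a i) c := by
    intro A
    induction A using Finset.induction_on with
    | empty => simpa using h
    | insert k A hkA ih =>
      refine ih.contract_coord k (fun a i hi => ?_) (fun a b => ?_)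
      · simp [hi]
      · simpa [hkA] using hk a b k
  simpa using this Finset.univ

theorem RadBound.neg {ι : Type*} {m : ℕ} {v : ι → Fin m → ℝ} {c : ℝ}
    (h : RadBound v c) : RadBound (fun a i => -v a i) c :=
  h.contract fun a b i => by rw [neg_sub_neg, abs_sub_comm]

theorem exists_abs_sum_mul_le {n : ℕ} [Nonempty (Fin n)] (u a : Fin n → ℝ) :
    ∃ j, |∑ i, u i * a i| ≤ l1norm u * |a j| := by
  obtain ⟨j, hj⟩ := Finite.exists_max fun i => |a i|
  refine ⟨j, (Finset.abs_sum_le_sum_abs _ _).trans ?_⟩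
  rw [l1norm, Finset.sum_mul]
  refine Finset.sum_le_sum fun i _ => ?_
  rw [abs_mul]
  exact mul_le_mul_of_nonneg_left (hj i) (abs_nonneg _)

theorem signedSum_sum_mul {n m : ℕ} (ε : Fin m → Bool) (u : Fin n → ℝ) (v : Fin n → Fin m → ℝ) :
    signedSum ε (fun i => ∑ j, u j * v j i) = ∑ j, u j * signedSum ε (v j) := by
  simp only [signedSum, Finset.mul_sum]
  rw [Finset.sum_comm]
  exact Finset.sum_congr rfl fun _ _ => Finset.sum_congr rfl fun _ _ => by ring

/-- Sign patterns with a non-negative sum are charged to the class and the others to its negative;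
on the remaining patterns each of the two selections picks the zero element. This costs the factor
`2`. -/
theorem RadBound.sum_abs_le {ι : Type*} {m : ℕ} {v : ι → Fin m → ℝ} {c : ℝ}
    (h : RadBound v c) {a : ι} (ha : v a = 0) (s : (Fin m → Bool) → ι) :
    ∑ ε, |signedSum ε (v (s ε))| ≤ 2 * c := by
  classical
  have h1 := h fun ε => if 0 ≤ signedSum ε (v (s ε)) then s ε else a
  have h2 := h.neg fun ε => if 0 ≤ signedSum ε (v (s ε)) then a else s ε
  rw [two_mul]
  refine le_trans (le_of_eq ?_) (add_le_add h1 h2)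
  rw [← Finset.sum_add_distrib]
  refine Finset.sum_congr rfl fun ε _ => ?_
  split_ifs with hs
  · simp [ha, signedSum, -abs_eq_self]
    exact abs_of_nonneg hs
  · rw [abs_of_neg (not_le.1 hs)]
    simp [ha, signedSum]

/-- Linear combinations with bounded `ℓ¹` norm of elements of a class. -/
theorem RadBound.linearCombination {ι κ : Type*} {n m : ℕ} {v : ι → Fin m → ℝ} {c : ℝ}
    (h : RadBound v c) {a : ι} (ha : v a = 0) {L : ℝ} (hL : 0 ≤ L) (u : κ → Vec n)
    (hu : ∀ k, l1norm (u k) ≤ L) (p : κ → Fin n → ι) :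
    RadBound (fun k i => ∑ j, u k j * v (p k j) i) (2 * L * c) := by
  intro s
  rcases isEmpty_or_nonempty (Fin n) with hn | hn
  -- Without channels no maximal coordinate exists, but every combination vanishes.
  · have := h.nonneg ha
    simp only [Finset.univ_eq_empty, Finset.sum_empty, signedSum, mul_zero,
      Finset.sum_const_zero]
    positivity
  · choose J hJ using fun ε => exists_abs_sum_mul_le (u (s ε))
      fun j => signedSum ε (v (p (s ε) j))
    calc ∑ ε, signedSum ε (fun i => ∑ j, u (s ε) j * v (p (s ε) j) i)
        ≤ ∑ ε, L * |signedSum ε (v (p (s ε) (J ε)))| := by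
          refine Finset.sum_le_sum fun ε _ => ?_
          rw [signedSum_sum_mul ε (u (s ε)) fun j => v (p (s ε) j)]
          exact (le_abs_self _).trans ((hJ ε).trans
            (mul_le_mul_of_nonneg_right (hu _) (abs_nonneg _)))
      _ = L * ∑ ε, |signedSum ε (v (p (s ε) (J ε)))| := by rw [Finset.mul_sum]
      _ ≤ L * (2 * c) :=
        mul_le_mul_of_nonneg_left (h.sum_abs_le ha fun ε => p (s ε) (J ε)) hL
      _ = 2 * L * c := by ring

theorem sum_exp_signedSum {m : ℕ} (x : Fin m → ℝ) :
    ∑ ε, Real.exp (signedSum ε x) = ∏ i, (2 * Real.cosh (x i)) := by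
  have : ∀ i, 2 * Real.cosh (x i) = ∑ b : Bool, Real.exp (sgn b * x i) := by
    intro i
    rw [Real.cosh_eq]
    simp [sgn]
    ring
  simp only [this]
  rw [Finset.prod_univ_sum, Fintype.piFinset_univ]
  simp [signedSum, Real.exp_sum]

theorem sum_exp_signedSum_le {m : ℕ} {x : Fin m → ℝ} {r : ℝ} (hx : ∀ i, |x i| ≤ r) :
    ∑ ε, Real.exp (signedSum ε x) ≤ 2 ^ m * Real.exp (m * r ^ 2 / 2) := by
  rw [sum_exp_signedSum]
  calc ∏ i, (2 * Real.cosh (x i)) ≤ ∏ _i : Fin m, (2 * Real.exp (r ^ 2 / 2)) := by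
        refine Finset.prod_le_prod (fun i _ => by positivity) fun i _ => ?_
        refine mul_le_mul_of_nonneg_left ((Real.cosh_le_exp_half_sq _).trans ?_) (by norm_num)
        refine Real.exp_le_exp.2 ?_
        have := sq_le_sq' (abs_le.1 (hx i)).1 (abs_le.1 (hx i)).2
        linarith
    _ = 2 ^ m * Real.exp (m * r ^ 2 / 2) := by
        rw [Finset.prod_const, Finset.card_univ, Fintype.card_fin, mul_pow, ← Real.exp_nat_mul]
        congr 2
        ring

/-- The exponential moment method: the selected absolute value is dominated by the sum over all `n`
vectors and their negatives, whence `log (2 * n)`. -/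
theorem sum_abs_signedSum_le_of_pos {n m : ℕ} {x : Fin n → Fin m → ℝ} {r : ℝ}
    (hx : ∀ j i, |x j i| ≤ r) (s : (Fin m → Bool) → Fin n) {l : ℝ} (hl : 0 < l) :
    ∑ ε, |signedSum ε (x (s ε))| ≤
      2 ^ m * ((Real.log (2 * n) + m * (l * r) ^ 2 / 2) / l) := by
  have hn : (0 : ℝ) < n := by
    have := (s fun _ => true).pos
    exact_mod_cast this
  set C := Real.log (2 * n) + m * (l * r) ^ 2 / 2 with hC
  have hmul : ∀ (b : ℝ) ε j, b * signedSum ε (x j) = signedSum ε fun i => b * x j i := by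
    intro b ε j
    simp only [signedSum, Finset.mul_sum]
    exact Finset.sum_congr rfl fun _ _ => by ring
  have hb : ∀ b : ℝ, |b| ≤ l → ∀ j i, |b * x j i| ≤ l * r := fun b hb j i => by
    rw [abs_mul]
    exact mul_le_mul hb (hx j i) (abs_nonneg _) hl.le
  have hexp : ∑ ε, Real.exp (l * |signedSum ε (x (s ε))|) ≤ 2 ^ m * Real.exp C := by
    calc ∑ ε, Real.exp (l * |signedSum ε (x (s ε))|)
        ≤ ∑ ε, ∑ j, (Real.exp (l * signedSum ε (x j)) + Real.exp (-l * signedSum ε (x j))) := by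
          refine Finset.sum_le_sum fun ε _ => ?_
          refine le_trans ?_ (Finset.single_le_sum
            (f := fun j => Real.exp (l * signedSum ε (x j)) + Real.exp (-l * signedSum ε (x j)))
            (fun j _ => by positivity) (Finset.mem_univ (s ε)))
          rcases abs_cases (signedSum ε (x (s ε))) with ⟨h, _⟩ | ⟨h, _⟩
          · rw [h]
            exact le_add_of_nonneg_right (Real.exp_pos _).le
          · rw [h, mul_neg, ← neg_mul]
            exact le_add_of_nonneg_left (Real.exp_pos _).le
      _ = ∑ j, (∑ ε, Real.exp (signedSum ε fun i => l * x j i)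
            + ∑ ε, Real.exp (signedSum ε fun i => -l * x j i)) := by
          rw [Finset.sum_comm]
          simp only [hmul, Finset.sum_add_distrib]
      _ ≤ ∑ _j : Fin n, (2 ^ m * Real.exp (m * (l * r) ^ 2 / 2)
            + 2 ^ m * Real.exp (m * (l * r) ^ 2 / 2)) :=
          Finset.sum_le_sum fun j _ => add_le_add
            (sum_exp_signedSum_le (hb l (abs_of_pos hl).le j))
            (sum_exp_signedSum_le (hb (-l) (by rw [abs_neg]; exact (abs_of_pos hl).le) j))
      _ = 2 ^ m * Real.exp C := by
          rw [hC, Real.exp_add, Real.exp_log (by positivity)]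
          simp
          ring
  -- This replaces Jensen's inequality: `1 + y ≤ exp y` at `y = l * |·| - C`, where `C` makes the
  -- average of `exp y` at most `1`.
  have hlin : ∑ ε, (l * |signedSum ε (x (s ε))| - C + 1)
      ≤ ∑ ε, Real.exp (l * |signedSum ε (x (s ε))|) * Real.exp (-C) :=
    Finset.sum_le_sum fun ε _ => by
      rw [← Real.exp_add]
      exact Real.add_one_le_exp _
  rw [← Finset.sum_mul] at hlin
  have h2 : (∑ ε, Real.exp (l * |signedSum ε (x (s ε))|)) * Real.exp (-C) ≤ 2 ^ m := by
    refine (mul_le_mul_of_nonneg_right hexp (Real.exp_pos _).le).trans_eq ?_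
    rw [mul_assoc, ← Real.exp_add]
    simp
  have h3 := hlin.trans h2
  simp only [Finset.sum_add_distrib, Finset.sum_sub_distrib, ← Finset.mul_sum, Finset.sum_const,
    Finset.card_univ, Fintype.card_fun, Fintype.card_bool, Fintype.card_fin, nsmul_eq_mul,
    Nat.cast_pow, Nat.cast_ofNat, mul_one] at h3
  rw [mul_div_assoc', le_div_iff₀ hl]
  linarith

/-- Massart's bound for the maximum of finitely many signed sums. -/
theorem sum_abs_signedSum_le {n m : ℕ} (hm : 0 < m) {x : Fin n → Fin m → ℝ} {r : ℝ}
    (hx : ∀ j i, |x j i| ≤ r) (s : (Fin m → Bool) → Fin n) :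
    ∑ ε, |signedSum ε (x (s ε))| ≤ 2 ^ m * (r * √(2 * m * Real.log (2 * n))) := by
  have hm' : (0 : ℝ) < m := by exact_mod_cast hm
  have hn : (1 : ℝ) ≤ n := by
    have := (s fun _ => true).pos
    exact_mod_cast this
  have hr : 0 ≤ r := (abs_nonneg _).trans (hx (s fun _ => true) ⟨0, hm⟩)
  have hlog : 0 < Real.log (2 * n) := Real.log_pos (by linarith)
  rcases hr.eq_or_lt with rfl | hr
  · have : ∀ j, x j = 0 := fun j => funext fun i => abs_nonpos_iff.1 (hx j i)
    simp [this, signedSum]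
  · have hA : 0 < √(2 * m * Real.log (2 * n)) := Real.sqrt_pos.2 (by positivity)
    have hA2 : √(2 * m * Real.log (2 * n)) ^ 2 = 2 * m * Real.log (2 * n) :=
      Real.sq_sqrt (by positivity)
    -- This `l` minimizes the right-hand side; it needs `r ≠ 0`.
    refine (sum_abs_signedSum_le_of_pos hx s
      (l := √(2 * m * Real.log (2 * n)) / (m * r)) (by positivity)).trans_eq ?_
    congr 1
    set A := √(2 * m * Real.log (2 * n))
    have : Real.log (2 * n) = A ^ 2 / (2 * m) := by rw [hA2]; field_simp
    rw [this]
    field_simp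
    ring

theorem zero_mem_neuronClass {n : ℕ} (σ : ℝ → ℝ) {Λ : ℕ → ℝ} (hΛ : ∀ t, 0 ≤ Λ t) (t : ℕ) :
    (fun _ => 0 : Vec n → ℝ) ∈ neuronClass σ Λ t := by
  induction t with
  | zero => exact ⟨0, by simpa [l1norm] using hΛ 0, by simp⟩
  | succ t ih => exact ⟨0, fun _ _ => 0, by simpa [l1norm] using hΛ (t + 1), fun _ => ih, by simp⟩

/-- The empirical Rademacher complexity of the neuron classes. -/
theorem radBound_neuronClass {n m : ℕ} (hm : 0 < m) {σ : ℝ → ℝ} (hσ : LipschitzWith 1 σ)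
    (hσ0 : σ 0 = 0) {Λ : ℕ → ℝ} (hΛ : ∀ t, 0 ≤ Λ t) {x : Fin m → Vec n} {r : ℝ}
    (hx : ∀ i j, |x i j| ≤ r) (hr : 0 ≤ r) (t : ℕ) :
    RadBound (fun (ψ : neuronClass σ Λ t) i => ψ.1 (x i))
      (2 ^ m * m * r * √(Real.log (2 * n) / (2 * m)) * weightProd Λ t) := by
  have hm' : (0 : ℝ) < m := by exact_mod_cast hm
  induction t with
  | zero =>
    intro s
    choose u hu hψ using fun ε => (s ε).2
    rcases isEmpty_or_nonempty (Fin n) with hn | hn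
    · simp only [hψ, Finset.univ_eq_empty, Finset.sum_empty, signedSum, mul_zero,
        Finset.sum_const_zero, weightProd, zero_add, Finset.prod_range_one]
      have := hΛ 0
      positivity
    · choose J hJ using fun ε => exists_abs_sum_mul_le (u ε)
        fun j => signedSum ε fun i => x i j
      -- The factor `2` produced here is the one that accompanies `Λ 0` in `weightProd`.
      have hsq : √(2 * m * Real.log (2 * n)) = 2 * m * √(Real.log (2 * n) / (2 * m)) := by
        rw [show 2 * m * Real.log (2 * n) = (2 * m) ^ 2 * (Real.log (2 * n) / (2 * m)) by
          field_simp, Real.sqrt_mul (by positivity), Real.sqrt_sq (by positivity)]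
      calc ∑ ε, signedSum ε (fun i => (s ε).1 (x i))
          ≤ ∑ ε, Λ 0 * |signedSum ε fun i => x i (J ε)| := by
            refine Finset.sum_le_sum fun ε _ => ?_
            simp only [hψ]
            rw [signedSum_sum_mul ε (u ε) fun j i => x i j]
            exact (le_abs_self _).trans ((hJ ε).trans
              (mul_le_mul_of_nonneg_right (hu ε) (abs_nonneg _)))
        _ = Λ 0 * ∑ ε, |signedSum ε fun i => x i (J ε)| := by rw [Finset.mul_sum]
        _ ≤ Λ 0 * (2 ^ m * (r * √(2 * m * Real.log (2 * n)))) :=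
          mul_le_mul_of_nonneg_left
            (sum_abs_signedSum_le hm (x := fun j i => x i j) (fun j i => hx i j) J) (hΛ 0)
        _ = _ := by
          rw [hsq, weightProd]
          simp
          ring
  | succ t ih =>
    have h0 := zero_mem_neuronClass (n := n) σ hΛ t
    have hc : RadBound (fun (ψ : neuronClass σ Λ t) i => σ (ψ.1 (x i)))
        (2 ^ m * m * r * √(Real.log (2 * n) / (2 * m)) * weightProd Λ t) :=
      ih.contract fun a b i => by
        simpa [Real.dist_eq] using hσ.dist_le_mul (a.1 (x i)) (b.1 (x i))
    choose u p hu hp hψ using fun φ : neuronClass σ Λ (t + 1) => φ.2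
    -- The zero element needed for absolute values survives the activation because `σ 0 = 0`.
    have := hc.linearCombination (a := ⟨_, h0⟩) (by ext i; simp [hσ0]) (hΛ (t + 1)) u hu
      fun φ j => ⟨p φ j, hp φ j⟩
    convert this using 1
    · funext φ i
      rw [hψ φ]
    · rw [weightProd, Finset.prod_range_succ, ← weightProd]
      ring

/-! ### Concentration -/

theorem integrable_of_abs_le {Ω : Type*} [MeasurableSpace Ω] {P : Measure Ω} [IsFiniteMeasure P]
    {f : Ω → ℝ} (hf : Measurable f) {B : ℝ} (hB : ∀ a, |f a| ≤ B) : Integrable f P :=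
  Integrable.of_bound hf.aestronglyMeasurable B (Filter.Eventually.of_forall hB)

/-- Hoeffding's lemma: oscillation at most `c` confines `h` to an interval of length `c` starting at
its infimum. -/
theorem integral_exp_mul_le_of_oscillation {Ω : Type*} [MeasurableSpace Ω] (P : Measure Ω)
    [IsProbabilityMeasure P] {h : Ω → ℝ} (hh : Measurable h) {c : ℝ}
    (hc : ∀ a b, h a - h b ≤ c) (l : ℝ) :
    ∫ a, Real.exp (l * h a) ∂P ≤ Real.exp (l * ∫ a, h a ∂P + (l * c) ^ 2 / 8) := by
  obtain ⟨a₀⟩ : Nonempty Ω := nonempty_of_isProbabilityMeasure P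
  have hbdd : BddBelow (Set.range h) := by
    refine ⟨h a₀ - c, ?_⟩
    rintro _ ⟨a, rfl⟩
    linarith [hc a₀ a]
  have hmem : ∀ a, h a ∈ Set.Icc (⨅ a, h a) ((⨅ a, h a) + c) := fun a => by
    have : Nonempty Ω := ⟨a₀⟩
    refine ⟨ciInf_le hbdd a, ?_⟩
    have : h a - c ≤ ⨅ a, h a := le_ciInf fun b => by linarith [hc a b]
    linarith
  have hsub := (ProbabilityTheory.hasSubgaussianMGF_of_mem_Icc (μ := P) hh.aemeasurable
    (Filter.Eventually.of_forall hmem)).mgf_le l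
  have e1 : ∀ a, Real.exp (l * h a) =
      Real.exp (l * ∫ a, h a ∂P) * Real.exp (l * (h a - ∫ a, h a ∂P)) := fun a => by
    rw [← Real.exp_add]
    congr 1
    ring
  simp only [e1]
  rw [integral_const_mul, Real.exp_add]
  refine mul_le_mul_of_nonneg_left (hsub.trans_eq ?_) (Real.exp_pos _).le
  congr 1
  simp only [add_sub_cancel_left, NNReal.coe_pow, NNReal.coe_div, coe_nnnorm, Real.norm_eq_abs,
    NNReal.coe_ofNat, div_pow, sq_abs]
  ring

/-- The moment generating function of a function of independent variables with bounded
differences. -/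
theorem integral_exp_mul_le_of_boundedDiff {Z : Type*} [MeasurableSpace Z] (D : Measure Z)
    [IsProbabilityMeasure D] (l c B : ℝ) (m : ℕ) (f : (Fin m → Z) → ℝ) (hf : Measurable f)
    (hB : ∀ S, |f S| ≤ B) (hc : ∀ S i z, f (Function.update S i z) - f S ≤ c) :
    ∫ S, Real.exp (l * f S) ∂(Measure.pi fun _ => D) ≤
      Real.exp (l * ∫ S, f S ∂(Measure.pi fun _ => D) + m * (l * c) ^ 2 / 8) := by
  induction m with
  | zero =>
    rw [Measure.pi_of_empty]
    simp
  | succ m ih =>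
    -- Split off the first coordinate: the induction hypothesis applies to the sections, and
    -- Hoeffding's lemma to their means `h`.
    have hmp := (measurePreserving_piFinSuccAbove (fun _ : Fin (m + 1) => D) 0).symm
    have htr : ∀ G : (Fin (m + 1) → Z) → ℝ, ∫ S, G S ∂(Measure.pi fun _ => D) =
        ∫ p : Z × (Fin m → Z), G (Fin.cons p.1 p.2) ∂(D.prod (Measure.pi fun _ => D)) := by
      intro G
      rw [← hmp.integral_comp' G]
      simp [MeasurableEquiv.piFinSuccAbove, Fin.insertNthEquiv]
    have hcons : Measurable fun p : Z × (Fin m → Z) => (Fin.cons p.1 p.2 : Fin (m + 1) → Z) := by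
      refine measurable_pi_lambda _ fun i => ?_
      refine Fin.cases ?_ (fun j => ?_) i
      · simpa using measurable_fst
      · simpa [Function.comp_def] using (measurable_pi_apply j).comp measurable_snd
    set g : Z × (Fin m → Z) → ℝ := fun p => f (Fin.cons p.1 p.2) with hg
    have hgm : Measurable g := hf.comp hcons
    have hgB : ∀ p, |g p| ≤ B := fun p => hB _
    have hgi : Integrable g (D.prod (Measure.pi fun _ => D)) := integrable_of_abs_le hgm hgB
    have hsec : ∀ z, Measurable fun S => g (z, S) := fun z => hgm.comp measurable_prodMk_left
    have hseci : ∀ z, Integrable (fun S => g (z, S)) (Measure.pi fun _ => D) := fun z =>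
      integrable_of_abs_le (hsec z) fun S => hgB _
    set h : Z → ℝ := fun z => ∫ S, g (z, S) ∂(Measure.pi fun _ => D) with hh
    have hhm : Measurable h := hgm.stronglyMeasurable.integral_prod_right.measurable
    have hexpi : Integrable (fun p => Real.exp (l * g p)) (D.prod (Measure.pi fun _ => D)) := by
      refine integrable_of_abs_le (hgm.const_mul l).exp (B := Real.exp (|l| * B)) fun p => ?_
      rw [Real.abs_exp]
      refine Real.exp_le_exp.2 ((le_abs_self _).trans ?_)
      rw [abs_mul]
      exact mul_le_mul_of_nonneg_left (hgB p) (abs_nonneg _)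
    -- The one-sided difference bound suffices, since it holds from every starting point.
    have hosc : ∀ a b, h a - h b ≤ c := by
      intro a b
      simp only [hh]
      rw [← integral_sub (hseci a) (hseci b)]
      refine (integral_mono ((hseci a).sub (hseci b)) (integrable_const c) fun S => ?_).trans_eq
        (by simp)
      have := hc (Fin.cons b S) 0 a
      rwa [Fin.update_cons_zero] at this
    have hhB : ∀ z, |h z| ≤ B := fun z => by
      have := norm_integral_le_of_norm_le_const (μ := Measure.pi fun _ : Fin m => D)
        (f := fun S => g (z, S)) (Filter.Eventually.of_forall fun S => hgB _)
      simpa using this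
    have hexph : Integrable (fun z => Real.exp (l * h z)) D := by
      refine integrable_of_abs_le (hhm.const_mul l).exp (B := Real.exp (|l| * B)) fun p => ?_
      rw [Real.abs_exp]
      refine Real.exp_le_exp.2 ((le_abs_self _).trans ?_)
      rw [abs_mul]
      exact mul_le_mul_of_nonneg_left (hhB p) (abs_nonneg _)
    rw [htr, htr, integral_prod _ hexpi, integral_prod _ hgi]
    calc ∫ z, ∫ S, Real.exp (l * g (z, S)) ∂(Measure.pi fun _ => D) ∂D
        ≤ ∫ z, Real.exp (l * h z) * Real.exp (m * (l * c) ^ 2 / 8) ∂D := by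
          refine integral_mono hexpi.integral_prod_left (hexph.mul_const _) fun z => ?_
          refine (ih (fun S => g (z, S)) (hsec z) (fun S => hgB _) fun S i y => ?_).trans_eq
            (Real.exp_add _ _)
          have := hc (Fin.cons z S) i.succ y
          rwa [← Fin.cons_update] at this
      _ = (∫ z, Real.exp (l * h z) ∂D) * Real.exp (m * (l * c) ^ 2 / 8) := integral_mul_const _ _
      _ ≤ Real.exp (l * ∫ z, h z ∂D + (l * c) ^ 2 / 8) * Real.exp (m * (l * c) ^ 2 / 8) :=
          mul_le_mul_of_nonneg_right (integral_exp_mul_le_of_oscillation D hhm hosc l)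
            (Real.exp_pos _).le
      _ = Real.exp (l * ∫ z, h z ∂D + (m + 1 : ℕ) * (l * c) ^ 2 / 8) := by
          rw [← Real.exp_add]
          congr 1
          push_cast
          ring

/-- McDiarmid's inequality. -/
theorem measureReal_ge_le_of_boundedDiff {Z : Type*} [MeasurableSpace Z] (D : Measure Z)
    [IsProbabilityMeasure D] {m : ℕ} (hm : 0 < m) {B : ℝ} {f : (Fin m → Z) → ℝ}
    (hf : Measurable f) (hB : ∀ S, |f S| ≤ B)
    (hc : ∀ S i z, f (Function.update S i z) - f S ≤ 1 / m) {t : ℝ} (ht : 0 ≤ t) :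
    (Measure.pi fun _ => D).real {S | ∫ S, f S ∂(Measure.pi fun _ => D) + t ≤ f S} ≤
      Real.exp (-(2 * m * t ^ 2)) := by
  have hm' : (0 : ℝ) < m := by exact_mod_cast hm
  set P : Measure (Fin m → Z) := Measure.pi fun _ => D
  -- Minimizer of the Chernoff exponent `-l * t + l ^ 2 / (8 * m)`.
  set l : ℝ := 4 * m * t
  have hl : 0 ≤ l := by positivity
  have hexpi : Integrable (fun S => Real.exp (l * f S)) P := by
    refine integrable_of_abs_le (hf.const_mul l).exp (B := Real.exp (|l| * B)) fun p => ?_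
    rw [Real.abs_exp]
    refine Real.exp_le_exp.2 ((le_abs_self _).trans ?_)
    rw [abs_mul]
    exact mul_le_mul_of_nonneg_left (hB p) (abs_nonneg _)
  have h1 := ProbabilityTheory.measure_ge_le_exp_mul_mgf (μ := P) (X := f)
    (∫ S, f S ∂P + t) hl hexpi
  refine h1.trans ((mul_le_mul_of_nonneg_left
    (integral_exp_mul_le_of_boundedDiff D l (1 / m) B m f hf hB hc) (Real.exp_pos _).le).trans_eq
    ?_)
  rw [← Real.exp_add]
  congr 1
  simp only [l, P]
  field_simp
  ring

/-! ### Symmetrization and uniform deviation -/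

theorem ciSup_le_ciSup_add {ι : Type*} [Finite ι] [Nonempty ι] {a b : ι → ℝ} {c : ℝ}
    (h : ∀ k, a k ≤ b k + c) : ⨆ k, a k ≤ (⨆ k, b k) + c :=
  ciSup_le fun k => (h k).trans (add_le_add_left (le_ciSup (Set.finite_range b).bddAbove k) c)

theorem abs_ciSup_le {ι : Type*} [Finite ι] [Nonempty ι] {a : ι → ℝ} {B : ℝ}
    (h : ∀ k, |a k| ≤ B) : |⨆ k, a k| ≤ B := by
  obtain ⟨k, hk⟩ := exists_eq_ciSup_of_finite (f := a)
  rw [← hk]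
  exact h k

/-- The empirical mean. -/
noncomputable def empMean {Z : Type*} {m : ℕ} (l : Z → ℝ) (S : Fin m → Z) : ℝ := (∑ i, l (S i)) / m

theorem measurable_empMean {Z : Type*} [MeasurableSpace Z] {m : ℕ} {l : Z → ℝ}
    (hl : Measurable l) : Measurable (empMean (m := m) l) :=
  (Finset.measurable_sum _ fun i _ => hl.comp (measurable_pi_apply i)).div_const _

theorem empMean_nonneg {Z : Type*} {m : ℕ} {l : Z → ℝ} (h0 : ∀ z, 0 ≤ l z) (S : Fin m → Z) :
    0 ≤ empMean l S :=
  div_nonneg (Finset.sum_nonneg fun _ _ => h0 _) (Nat.cast_nonneg m)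

theorem empMean_le_one {Z : Type*} {m : ℕ} {l : Z → ℝ} (h1 : ∀ z, l z ≤ 1) (S : Fin m → Z) :
    empMean l S ≤ 1 := by
  refine div_le_one_of_le₀ ?_ (Nat.cast_nonneg m)
  refine (Finset.sum_le_sum fun i _ => h1 (S i)).trans_eq ?_
  simp

theorem integral_empMean {Z : Type*} [MeasurableSpace Z] (D : Measure Z) [IsProbabilityMeasure D]
    {m : ℕ} (hm : 0 < m) {l : Z → ℝ} (hl : Integrable l D) :
    ∫ S, empMean (m := m) l S ∂(Measure.pi fun _ => D) = ∫ z, l z ∂D := by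
  have hm' : (m : ℝ) ≠ 0 := by exact_mod_cast hm.ne'
  have hi : ∀ i : Fin m, Integrable (fun S : Fin m → Z => l (S i)) (Measure.pi fun _ => D) :=
    fun i => ((measurePreserving_eval (fun _ : Fin m => D) i).integrable_comp
      hl.aestronglyMeasurable).2 hl
  simp only [empMean]
  rw [integral_div, integral_finsetSum _ fun i _ => hi i]
  have e : ∀ i : Fin m, ∫ S : Fin m → Z, l (S i) ∂(Measure.pi fun _ => D) = ∫ z, l z ∂D :=
    fun i => integral_comp_eval (μ := fun _ : Fin m => D) hl.aestronglyMeasurable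
  simp [e, hm']

theorem integral_mem_Icc_of_mem_Icc {Z : Type*} [MeasurableSpace Z] (D : Measure Z)
    [IsProbabilityMeasure D] {l : Z → ℝ} (h0 : ∀ z, 0 ≤ l z) (h1 : ∀ z, l z ≤ 1)
    (hl : Integrable l D) : ∫ z, l z ∂D ∈ Set.Icc (0 : ℝ) 1 :=
  ⟨integral_nonneg h0, (integral_mono hl (integrable_const 1) h1).trans_eq (by simp)⟩

theorem measurePreserving_swap_coordinates {Z : Type*} [MeasurableSpace Z] (D : Measure Z)
    [IsProbabilityMeasure D] {m : ℕ} (ε : Fin m → Bool) :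
    MeasurePreserving (fun (p : Fin m → Z × Z) i => cond (ε i) (p i) (p i).swap)
      (Measure.pi fun _ => D.prod D) (Measure.pi fun _ => D.prod D) := by
  refine measurePreserving_pi (fun _ => D.prod D) (fun _ => D.prod D)
    (f := fun i q => cond (ε i) q q.swap) fun i => ?_
  cases ε i
  · exact Measure.measurePreserving_swap
  · exact MeasurePreserving.id _

/-- The largest signed difference of the empirical means of the losses on two samples. -/
noncomputable def ghostDev {ι Z : Type*} {m : ℕ} (l : ι → Z → ℝ) (ε : Fin m → Bool) (p : Fin m → Z × Z) : ℝ :=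
  ⨆ k, signedSum ε (fun i => l k (p i).2 - l k (p i).1) / m

theorem ghostDev_swap {ι Z : Type*} {m : ℕ} (l : ι → Z → ℝ) (ε : Fin m → Bool)
    (p : Fin m → Z × Z) :
    ghostDev l (fun _ => true) (fun i => cond (ε i) (p i) (p i).swap) = ghostDev l ε p := by
  simp only [ghostDev, signedSum]
  congr 1
  funext k
  congr 1
  refine Finset.sum_congr rfl fun i _ => ?_
  cases ε i <;> simp [sgn]

theorem measurable_ghostDev {ι Z : Type*} [Finite ι] [MeasurableSpace Z] {m : ℕ}
    {l : ι → Z → ℝ} (hl : ∀ k, Measurable (l k)) (ε : Fin m → Bool) :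
    Measurable (ghostDev l ε) := by
  refine Measurable.iSup fun k => Measurable.div_const (Finset.measurable_sum _ fun i _ => ?_) _
  exact (((hl k).comp (measurable_snd.comp (measurable_pi_apply i))).sub
    ((hl k).comp (measurable_fst.comp (measurable_pi_apply i)))).const_mul _

theorem ghostDev_true {ι Z : Type*} {m : ℕ} (l : ι → Z → ℝ) (p : Fin m → Z × Z) :
    ghostDev l (fun _ => true) p =
      ⨆ k, (empMean (l k) (fun i => (p i).2) - empMean (l k) fun i => (p i).1) := by
  simp [ghostDev, signedSum, sgn, empMean, sub_div]

theorem abs_empMean_sub_le {Z : Type*} {m : ℕ} {l : Z → ℝ} (h0 : ∀ z, 0 ≤ l z)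
    (h1 : ∀ z, l z ≤ 1) (S S' : Fin m → Z) : |empMean l S - empMean l S'| ≤ 1 := by
  rw [abs_le]
  constructor <;> linarith [empMean_nonneg h0 S, empMean_nonneg h0 S', empMean_le_one h1 S,
    empMean_le_one h1 S']

theorem abs_ghostDev_le {ι Z : Type*} [Finite ι] [Nonempty ι] {m : ℕ} {l : ι → Z → ℝ}
    (h0 : ∀ k z, 0 ≤ l k z) (h1 : ∀ k z, l k z ≤ 1) (ε : Fin m → Bool) (p : Fin m → Z × Z) :
    |ghostDev l ε p| ≤ 1 := by
  rw [← ghostDev_swap, ghostDev_true]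
  exact abs_ciSup_le fun k => abs_empMean_sub_le (h0 k) (h1 k) _ _

/-- As the family is finite, the maximizers form a selection; the differences split into one
Rademacher sum for each sample. -/
theorem sum_ghostDev_le {ι Z : Type*} [Finite ι] [Nonempty ι] {m : ℕ} {l : ι → Z → ℝ}
    {K : (Fin m → Z) → ℝ} (hK : ∀ S, RadBound (fun k i => l k (S i)) (K S))
    (p : Fin m → Z × Z) :
    ∑ ε, ghostDev l ε p ≤ (K (fun i => (p i).2) + K fun i => (p i).1) / m := by
  choose s hs using fun ε : Fin m → Bool => exists_eq_ciSup_of_finite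
    (f := fun k => signedSum ε (fun i => l k (p i).2 - l k (p i).1) / m)
  simp only [ghostDev, ← hs]
  rw [← Finset.sum_div]
  refine div_le_div_of_nonneg_right ?_ (Nat.cast_nonneg m)
  refine le_trans (le_of_eq ?_) (add_le_add (hK (fun i => (p i).2) s)
    ((hK fun i => (p i).1).neg s))
  rw [← Finset.sum_add_distrib]
  refine Finset.sum_congr rfl fun ε _ => ?_
  simp only [signedSum]
  rw [← Finset.sum_add_distrib]
  exact Finset.sum_congr rfl fun i _ => by ring

/-- The largest excess of the expectation of a loss over its empirical mean. -/
noncomputable def supDev {ι Z : Type*} [MeasurableSpace Z] {m : ℕ} (D : Measure Z) (l : ι → Z → ℝ)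
    (S : Fin m → Z) : ℝ :=
  ⨆ k, (∫ z, l k z ∂D - empMean (l k) S)

theorem measurable_supDev {ι Z : Type*} [Finite ι] [MeasurableSpace Z] {m : ℕ} (D : Measure Z)
    {l : ι → Z → ℝ} (hl : ∀ k, Measurable (l k)) : Measurable (supDev (m := m) D l) :=
  Measurable.iSup fun k => (measurable_empMean (hl k)).const_sub _

theorem abs_supDev_le {ι Z : Type*} [Finite ι] [Nonempty ι] [MeasurableSpace Z] {m : ℕ}
    (D : Measure Z) [IsProbabilityMeasure D] {l : ι → Z → ℝ} (hl : ∀ k, Measurable (l k))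
    (h0 : ∀ k z, 0 ≤ l k z) (h1 : ∀ k z, l k z ≤ 1) (S : Fin m → Z) : |supDev D l S| ≤ 1 := by
  refine abs_ciSup_le fun k => ?_
  have hi : Integrable (l k) D := integrable_of_abs_le (hl k) fun z => by
    rw [abs_of_nonneg (h0 k z)]
    exact h1 k z
  have := integral_mem_Icc_of_mem_Icc D (h0 k) (h1 k) hi
  rw [abs_le]
  constructor <;> linarith [this.1, this.2, empMean_nonneg (h0 k) S, empMean_le_one (h1 k) S]

/-- The expectation of a loss is the mean of its empirical mean on an independent ghost sample, and
a supremum of integrals is at most the integral of the supremum. -/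
theorem integral_supDev_le_ghostDev {ι Z : Type*} [Finite ι] [Nonempty ι] [MeasurableSpace Z]
    {m : ℕ} (hm : 0 < m) (D : Measure Z) [IsProbabilityMeasure D] {l : ι → Z → ℝ}
    (hl : ∀ k, Measurable (l k)) (h0 : ∀ k z, 0 ≤ l k z) (h1 : ∀ k z, l k z ≤ 1) :
    ∫ S, supDev (m := m) D l S ∂(Measure.pi fun _ => D) ≤
      ∫ p, ghostDev (m := m) l (fun _ => true) p ∂(Measure.pi fun _ => D.prod D) := by
  set P : Measure (Fin m → Z) := Measure.pi fun _ => D with hP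
  have hmp := measurePreserving_arrowProdEquivProdArrow Z Z (Fin m) (fun _ => D) fun _ => D
  let G : (Fin m → Z) × (Fin m → Z) → ℝ := fun q =>
    ⨆ k, (empMean (l k) q.2 - empMean (l k) q.1)
  have hG : ∫ p, ghostDev (m := m) l (fun _ => true) p ∂(Measure.pi fun _ => D.prod D) =
      ∫ q, G q ∂(P.prod P) := by
    rw [← hmp.integral_comp' G]
    exact integral_congr_ae (Filter.Eventually.of_forall fun p => ghostDev_true l p)
  have hGm : Measurable G := Measurable.iSup fun k =>
    ((measurable_empMean (hl k)).comp measurable_snd).sub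
      ((measurable_empMean (hl k)).comp measurable_fst)
  have hGB : ∀ q, |G q| ≤ 1 := fun q => abs_ciSup_le fun k =>
    abs_empMean_sub_le (h0 k) (h1 k) _ _
  have hGi : Integrable G (P.prod P) := integrable_of_abs_le hGm hGB
  rw [hG, integral_prod _ hGi]
  refine integral_mono (integrable_of_abs_le (measurable_supDev D hl) (abs_supDev_le D hl h0 h1))
    hGi.integral_prod_left fun S => ciSup_le fun k => ?_
  have hi : Integrable (l k) D := integrable_of_abs_le (hl k) fun z => by
    rw [abs_of_nonneg (h0 k z)]
    exact h1 k z
  have hei : Integrable (empMean (m := m) (l k)) P :=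
    integrable_of_abs_le (measurable_empMean (hl k)) fun S => by
      rw [abs_of_nonneg (empMean_nonneg (h0 k) S)]
      exact empMean_le_one (h1 k) S
  have e : ∫ z, l k z ∂D - empMean (l k) S =
      ∫ S', (empMean (l k) S' - empMean (l k) S) ∂P := by
    rw [integral_sub hei (integrable_const _), hP, integral_empMean D hm hi]
    simp
  rw [e]
  refine integral_mono (hei.sub (integrable_const _))
    (integrable_of_abs_le (hGm.comp measurable_prodMk_left) fun S' => hGB _) fun S' => ?_
  exact le_ciSup (f := fun k => empMean (l k) S' - empMean (l k) S)
    (Set.finite_range _).bddAbove k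

/-- Swapping an example with its ghost preserves the law and flips one sign, so all `2 ^ m` sign
patterns have the same integral and may be summed. -/
theorem integral_ghostDev_le {ι Z : Type*} [Finite ι] [Nonempty ι] [MeasurableSpace Z]
    {m : ℕ} (D : Measure Z) [IsProbabilityMeasure D] {l : ι → Z → ℝ}
    (hl : ∀ k, Measurable (l k)) (h0 : ∀ k z, 0 ≤ l k z) (h1 : ∀ k z, l k z ≤ 1)
    {K : (Fin m → Z) → ℝ} (hKi : Integrable K (Measure.pi fun _ => D))
    (hK : ∀ S, RadBound (fun k i => l k (S i)) (K S)) :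
    2 ^ m * ∫ p, ghostDev (m := m) l (fun _ => true) p ∂(Measure.pi fun _ => D.prod D) ≤
      2 * (∫ S, K S ∂(Measure.pi fun _ => D)) / m := by
  set PP : Measure (Fin m → Z × Z) := Measure.pi fun _ => D.prod D with hPP
  have hinv : ∀ ε, ∫ p, ghostDev l ε p ∂PP = ∫ p, ghostDev l (fun _ => true) p ∂PP := by
    intro ε
    simp only [← ghostDev_swap l ε]
    have hmp := measurePreserving_swap_coordinates D ε
    rw [← integral_map hmp.measurable.aemeasurable
      (measurable_ghostDev hl _).aestronglyMeasurable, hmp.map_eq]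
  have h2 : MeasurePreserving (fun (p : Fin m → Z × Z) i => (p i).2) PP
      (Measure.pi fun _ => D) :=
    measurePreserving_pi (fun _ => D.prod D) (fun _ => D) fun _ => measurePreserving_snd
  have h3 : MeasurePreserving (fun (p : Fin m → Z × Z) i => (p i).1) PP
      (Measure.pi fun _ => D) :=
    measurePreserving_pi (fun _ => D.prod D) (fun _ => D) fun _ => measurePreserving_fst
  have hgi : ∀ ε, Integrable (ghostDev l ε) PP := fun ε =>
    integrable_of_abs_le (measurable_ghostDev hl ε) (abs_ghostDev_le h0 h1 ε)
  have i2 : Integrable (fun p : Fin m → Z × Z => K fun i => (p i).2) PP :=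
    (h2.integrable_comp hKi.aestronglyMeasurable).2 hKi
  have i3 : Integrable (fun p : Fin m → Z × Z => K fun i => (p i).1) PP :=
    (h3.integrable_comp hKi.aestronglyMeasurable).2 hKi
  have e2 : ∫ p, K (fun i => (p i).2) ∂PP = ∫ S, K S ∂(Measure.pi fun _ => D) := by
    have := hKi.aestronglyMeasurable
    rw [← h2.map_eq] at this ⊢
    exact (integral_map h2.measurable.aemeasurable this).symm
  have e3 : ∫ p, K (fun i => (p i).1) ∂PP = ∫ S, K S ∂(Measure.pi fun _ => D) := by
    have := hKi.aestronglyMeasurable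
    rw [← h3.map_eq] at this ⊢
    exact (integral_map h3.measurable.aemeasurable this).symm
  calc 2 ^ m * ∫ p, ghostDev (m := m) l (fun _ => true) p ∂PP
      = ∑ ε, ∫ p, ghostDev l ε p ∂PP := by simp [hinv]
    _ = ∫ p, ∑ ε, ghostDev l ε p ∂PP := (integral_finsetSum _ fun ε _ => hgi ε).symm
    _ ≤ ∫ p, (K (fun i => (p i).2) + K fun i => (p i).1) / m ∂PP :=
        integral_mono (integrable_finsetSum _ fun ε _ => hgi ε) ((i2.add i3).div_const _)
          fun p => sum_ghostDev_le hK p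
    _ = _ := by
        rw [integral_div, integral_add i2 i3, e2, e3]
        ring

theorem supDev_update_sub_le {ι Z : Type*} [Finite ι] [Nonempty ι] [MeasurableSpace Z] {m : ℕ}
    (D : Measure Z) {l : ι → Z → ℝ} (h0 : ∀ k z, 0 ≤ l k z) (h1 : ∀ k z, l k z ≤ 1)
    (S : Fin m → Z) (i : Fin m) (z : Z) :
    supDev D l (Function.update S i z) - supDev D l S ≤ 1 / m := by
  rw [sub_le_iff_le_add', supDev, supDev]
  refine ciSup_le_ciSup_add fun k => ?_
  have e : ∀ S' : Fin m → Z, empMean (l k) S' =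
      l k (S' i) / m + (∑ j ∈ Finset.univ.erase i, l k (S' j)) / m := by
    intro S'
    rw [empMean, ← Finset.add_sum_erase _ _ (Finset.mem_univ i), add_div]
  have e' : ∑ j ∈ Finset.univ.erase i, l k (Function.update S i z j) =
      ∑ j ∈ Finset.univ.erase i, l k (S j) :=
    Finset.sum_congr rfl fun j hj => by rw [Function.update_of_ne (Finset.ne_of_mem_erase hj)]
  rw [e, e S, e', Function.update_self]
  have : l k (S i) / m ≤ 1 / m := div_le_div_of_nonneg_right (h1 k _) (Nat.cast_nonneg m)
  have : 0 ≤ l k z / m := div_nonneg (h0 k z) (Nat.cast_nonneg m)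
  linarith

/-- With high probability, the expectations of countably many losses exceed their empirical means
by at most twice the Rademacher complexity and a deviation term. -/
theorem measure_exists_dev_le {Z : Type*} [MeasurableSpace Z] {m : ℕ} (hm : 0 < m)
    (D : Measure Z) [IsProbabilityMeasure D] {l : ℕ → Z → ℝ} (hl : ∀ k, Measurable (l k))
    (h0 : ∀ k z, 0 ≤ l k z) (h1 : ∀ k z, l k z ≤ 1) {K : (Fin m → Z) → ℝ}
    (hKi : Integrable K (Measure.pi fun _ => D))
    (hK : ∀ S, RadBound (fun k i => l k (S i)) (K S)) {t : ℝ} (ht : 0 ≤ t) :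
    (Measure.pi fun _ => D) {S : Fin m → Z | ∃ k,
      2 * (∫ S, K S ∂(Measure.pi fun _ => D)) / m / 2 ^ m + t <
        ∫ z, l k z ∂D - empMean (l k) S} ≤ ENNReal.ofReal (Real.exp (-(2 * m * t ^ 2))) := by
  set P : Measure (Fin m → Z) := Measure.pi fun _ => D with hP
  set κ := 2 * (∫ S, K S ∂P) / m / 2 ^ m
  -- The bound for finite subfamilies does not depend on `N`, so it passes to the increasing union.
  let A : ℕ → Set (Fin m → Z) := fun N =>
    {S | ∃ k ≤ N, κ + t < ∫ z, l k z ∂D - empMean (l k) S}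
  have hA : {S : Fin m → Z | ∃ k, κ + t < ∫ z, l k z ∂D - empMean (l k) S} = ⋃ N, A N := by
    ext S
    simp only [A, Set.mem_ofPred_eq, Set.mem_iUnion]
    exact ⟨fun ⟨k, hk⟩ => ⟨k, k, le_rfl, hk⟩, fun ⟨_, k, _, hk⟩ => ⟨k, hk⟩⟩
  have hmono : Monotone A := fun N N' hN S ⟨k, hk, h⟩ => ⟨k, hk.trans hN, h⟩
  rw [hA, hmono.measure_iUnion]
  refine iSup_le fun N => ?_
  let l' : Fin (N + 1) → Z → ℝ := fun k => l k
  have hl' : ∀ k, Measurable (l' k) := fun k => hl k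
  have h0' : ∀ k z, 0 ≤ l' k z := fun k => h0 k
  have h1' : ∀ k z, l' k z ≤ 1 := fun k => h1 k
  have hmean : ∫ S, supDev D l' S ∂P ≤ κ := by
    rw [le_div_iff₀' (by positivity)]
    exact (mul_le_mul_of_nonneg_left (integral_supDev_le_ghostDev hm D hl' h0' h1')
      (by positivity)).trans (integral_ghostDev_le D hl' h0' h1' hKi
        fun S => (hK S).comp fun k : Fin (N + 1) => (k : ℕ))
  have hsub : A N ⊆ {S | ∫ S, supDev D l' S ∂P + t ≤ supDev D l' S} := by
    rintro S ⟨k, hk, h⟩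
    have := le_ciSup (f := fun k => ∫ z, l' k z ∂D - empMean (l' k) S)
      (Set.finite_range _).bddAbove ⟨k, Nat.lt_succ_of_le hk⟩
    simp only [Set.mem_ofPred_eq, supDev]
    simp only [supDev] at hmean
    have h : κ + t < ∫ z, l' ⟨k, Nat.lt_succ_of_le hk⟩ z ∂D -
      empMean (l' ⟨k, Nat.lt_succ_of_le hk⟩) S := h
    linarith
  refine (measure_mono hsub).trans ?_
  rw [← ofReal_measureReal]
  exact ENNReal.ofReal_le_ofReal (measureReal_ge_le_of_boundedDiff D hm (measurable_supDev D hl')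
    (abs_supDev_le D hl' h0' h1') (supDev_update_sub_le D h0' h1') ht)

/-! ### The class of residual networks -/

/-- The functions computed by residual networks of depth `T` with neurons in the given classes and
a final linear classifier of `ℓ¹` norm at most `C`. -/
def networkClass {n : ℕ} (σ : ℝ → ℝ) (Λ : ℕ → ℝ) (T : ℕ) (C : ℝ) : Set (Vec n → ℝ) :=
  {F | ∃ (w : Vec n) (φ : ℕ → Fin n → Vec n → ℝ), l1norm w ≤ C ∧
    (∀ t j, φ t j ∈ neuronClass σ Λ t) ∧
    F = fun x => ∑ t ∈ Finset.range (T + 1), ∑ j, w j * φ t j x}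

theorem repr_eq_sum {n : ℕ} (f : ℕ → Vec n → Vec n) (x : Vec n) (t : ℕ) :
    repr f x t = ∑ s ∈ Finset.range t, f s (moduleInput f x s) := by
  induction t with
  | zero => rfl
  | succ t ih =>
    rw [Finset.sum_range_succ, ← ih, add_comm (repr f x t)]
    rfl

theorem network_mem_networkClass {n m : ℕ} {T : ℕ} {σ : ℝ → ℝ} {Λ : ℕ → ℝ} (hΛ : ∀ t, 0 ≤ Λ t)
    {η : ℝ} {S : Sample n m} {f : ℕ → Vec n → Vec n} {w : ℕ → Vec n} {α : ℕ → ℝ}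
    (hr : IsRun σ Λ η T S f w α) {C : ℝ} (hC : l1norm (w (T + 1)) ≤ C) :
    network f w T ∈ networkClass σ Λ T C := by
  -- Layers beyond `T` do not enter the output, but the class demands members for all `t`; zero
  -- serves.
  refine ⟨w (T + 1), fun t j => if t ≤ T then fun x => f t (moduleInput f x t) j else fun _ => 0,
    hC, fun t j => ?_, ?_⟩
  · dsimp only
    split_ifs with ht
    · exact (hr.feasible t ht).1 j
    · exact zero_mem_neuronClass σ hΛ t
  · funext x
    simp only [network, hypModule]
    rw [Finset.sum_comm]
    refine Finset.sum_congr rfl fun j _ => ?_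
    rw [repr_eq_sum, Finset.sum_apply, Finset.mul_sum]
    refine Finset.sum_congr rfl fun t ht => ?_
    rw [if_pos (Nat.le_of_lt_succ (Finset.mem_range.1 ht))]

theorem continuous_of_mem_neuronClass {n : ℕ} {σ : ℝ → ℝ} (hσ : Continuous σ) {Λ : ℕ → ℝ} (t : ℕ)
    {φ : Vec n → ℝ} (hφ : φ ∈ neuronClass σ Λ t) : Continuous φ := by
  induction t generalizing φ with
  | zero =>
    obtain ⟨u, _, rfl⟩ := hφ
    fun_prop
  | succ t ih =>
    obtain ⟨u, ψ, _, hψ, rfl⟩ := hφ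
    exact continuous_finsetSum _ fun i _ => continuous_const.mul (hσ.comp (ih (hψ i)))

theorem continuous_of_mem_networkClass {n : ℕ} {σ : ℝ → ℝ} (hσ : Continuous σ) {Λ : ℕ → ℝ} {T : ℕ}
    {C : ℝ} {F : Vec n → ℝ} (hF : F ∈ networkClass σ Λ T C) : Continuous F := by
  obtain ⟨w, φ, _, hφ, rfl⟩ := hF
  exact continuous_finsetSum _ fun t _ => continuous_finsetSum _ fun j _ =>
    continuous_const.mul (continuous_of_mem_neuronClass hσ t (hφ t j))

theorem weightProd_nonneg {Λ : ℕ → ℝ} (hΛ : ∀ t, 0 ≤ Λ t) (t : ℕ) : 0 ≤ weightProd Λ t :=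
  Finset.prod_nonneg fun s _ => mul_nonneg zero_le_two (hΛ s)

theorem maxInput_nonneg {n m : ℕ} (S : Sample n m) : 0 ≤ maxInput S :=
  Real.iSup_nonneg fun _ => norm_nonneg _

theorem abs_le_maxInput {n m : ℕ} (S : Sample n m) (i : Fin m) (j : Fin n) :
    |(S i).1 j| ≤ maxInput S :=
  (norm_le_pi_norm (S i).1 j).trans
    (le_ciSup (f := fun i => ‖(S i).1‖) (Set.finite_range _).bddAbove i)

/-- The empirical Rademacher complexity of the class of residual networks. -/
theorem radBound_networkClass {n m : ℕ} (hm : 0 < m) {σ : ℝ → ℝ} (hσ : LipschitzWith 1 σ)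
    (hσ0 : σ 0 = 0) {Λ : ℕ → ℝ} (hΛ : ∀ t, 0 ≤ Λ t) (S : Sample n m) (T : ℕ) {C : ℝ}
    (hC : 0 ≤ C) :
    RadBound (fun (F : networkClass σ Λ T C) i => F.1 (S i).1)
      (2 * C * (2 ^ m * m * maxInput S * √(Real.log (2 * n) / (2 * m)) *
        ∑ t ∈ Finset.range (T + 1), weightProd Λ t)) := by
  choose w φ hw hφ hF using fun F : networkClass (n := n) σ Λ T C => F.2
  have := RadBound.sum (Finset.range (T + 1)) fun t _ =>
    (radBound_neuronClass hm hσ hσ0 hΛ (fun i j => abs_le_maxInput S i j)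
      (maxInput_nonneg S) t).linearCombination
      (a := ⟨_, zero_mem_neuronClass σ hΛ t⟩) rfl hC w hw fun F j => ⟨φ F t j, hφ F t j⟩
  convert this using 1
  · funext F i
    rw [hF F]
  · simp only [Finset.mul_sum]

/-! ### The ramp loss -/

/-- The ramp function: `1` up to `0`, `0` from `θ` on, and linear in between. -/
noncomputable def ramp (θ u : ℝ) : ℝ := max 0 (min 1 (1 - u / θ))

theorem ramp_nonneg (θ u : ℝ) : 0 ≤ ramp θ u := le_max_left _ _

theorem ramp_le_one (θ u : ℝ) : ramp θ u ≤ 1 := max_le zero_le_one (min_le_left _ _)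

theorem ramp_of_nonpos {θ u : ℝ} (hθ : 0 < θ) (hu : u ≤ 0) : ramp θ u = 1 := by
  have : u / θ ≤ 0 := div_nonpos_of_nonpos_of_nonneg hu hθ.le
  rw [ramp, min_eq_left (by linarith), max_eq_right zero_le_one]

theorem ramp_of_le {θ u : ℝ} (hθ : 0 < θ) (hu : θ ≤ u) : ramp θ u = 0 := by
  have : 1 ≤ u / θ := (one_le_div hθ).2 hu
  exact max_eq_left ((min_le_right _ _).trans (by linarith))

theorem abs_ramp_sub_le {θ : ℝ} (hθ : 0 < θ) (u v : ℝ) :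
    |ramp θ u - ramp θ v| ≤ |u - v| / θ := by
  have h1 := abs_max_sub_max_le_max (0 : ℝ) (min 1 (1 - u / θ)) 0 (min 1 (1 - v / θ))
  have h2 := abs_min_sub_min_le_max (1 : ℝ) (1 - u / θ) 1 (1 - v / θ)
  rw [sub_self, abs_zero, max_eq_right (b := |_|) (abs_nonneg _)] at h1 h2
  refine (h1.trans h2).trans_eq ?_
  rw [sub_sub_sub_cancel_left, ← sub_div, abs_div, abs_of_pos hθ, abs_sub_comm]

theorem continuous_ramp (θ : ℝ) : Continuous (ramp θ) := by
  unfold ramp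
  fun_prop

/-- Truncation of a label to `[-1, 1]`. -/
def clip (y : ℝ) : ℝ := max (-1) (min 1 y)

theorem abs_clip_le (y : ℝ) : |clip y| ≤ 1 :=
  abs_le.2 ⟨le_max_left _ _, max_le (by norm_num) (min_le_left _ _)⟩

theorem clip_of_label {y : ℝ} (hy : y = 1 ∨ y = -1) : clip y = y := by
  rcases hy with rfl | rfl <;> norm_num [clip]

/-- Clipping preserves errors for arbitrary real labels. Therefore the ramp loss can be estimated
for every sample, although labels are `±1` only almost surely. -/
theorem clip_mul_nonpos {y b : ℝ} (h : y * b ≤ 0) : clip y * b ≤ 0 := by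
  rcases lt_trichotomy y 0 with hy | rfl | hy
  · have hb : 0 ≤ b := nonneg_of_mul_nonpos_right h hy
    exact mul_nonpos_of_nonpos_of_nonneg
      (max_le (by norm_num) ((min_le_right _ _).trans hy.le)) hb
  · simp [clip]
  · have hb : b ≤ 0 := nonpos_of_mul_nonpos_right h hy
    exact mul_nonpos_of_nonneg_of_nonpos (le_max_of_le_right (le_min zero_le_one hy.le)) hb

/-- The ramp loss of the classifier `F`. -/
noncomputable def rampLoss {n : ℕ} (θ : ℝ) (F : Vec n → ℝ) (z : Vec n × ℝ) : ℝ :=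
  ramp θ (clip z.2 * F z.1)

theorem continuous_rampLoss {n : ℕ} (θ : ℝ) {F : Vec n → ℝ} (hF : Continuous F) :
    Continuous (rampLoss θ F) := by
  refine (continuous_ramp θ).comp (Continuous.mul ?_ (hF.comp continuous_fst))
  unfold clip
  fun_prop

theorem abs_rampLoss_le {n : ℕ} (θ : ℝ) (F : Vec n → ℝ) (z : Vec n × ℝ) :
    |rampLoss θ F z| ≤ 1 := by
  rw [rampLoss, abs_of_nonneg (ramp_nonneg _ _)]
  exact ramp_le_one _ _

/-- The ramp is `1/θ`-Lipschitz and clipped labels have absolute value at most `1`, so this is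
contraction from `F / θ`. -/
theorem RadBound.rampLoss {ι : Type*} {n m : ℕ} {S : Sample n m} {F : ι → Vec n → ℝ} {c : ℝ}
    (h : RadBound (fun k i => F k (S i).1) c) {θ : ℝ} (hθ : 0 < θ) :
    RadBound (fun k i => rampLoss θ (F k) (S i)) (1 / θ * c) := by
  refine (h.const_mul (one_div_pos.2 hθ).le).contract fun a b i => ?_
  refine (abs_ramp_sub_le hθ _ _).trans ?_
  rw [← mul_sub, ← mul_sub, abs_mul, abs_mul, abs_of_pos (one_div_pos.2 hθ), one_div,
    inv_mul_eq_div]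
  exact div_le_div_of_nonneg_right
    (mul_le_of_le_one_left (abs_nonneg _) (abs_clip_le _)) hθ.le

theorem measureReal_nonpos_le_integral_rampLoss {n : ℕ} (D : Measure (Vec n × ℝ))
    [IsProbabilityMeasure D] {θ : ℝ} (hθ : 0 < θ) {F : Vec n → ℝ} (hF : Continuous F) :
    D.real {z | z.2 * F z.1 ≤ 0} ≤ ∫ z, rampLoss θ F z ∂D := by
  have hs : MeasurableSet {z : Vec n × ℝ | z.2 * F z.1 ≤ 0} :=
    (isClosed_le (continuous_snd.mul (hF.comp continuous_fst)) continuous_const).measurableSet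
  rw [← integral_indicator_one hs]
  refine integral_mono ((integrable_const (1 : ℝ)).indicator hs)
    (integrable_of_abs_le (continuous_rampLoss θ hF).measurable (abs_rampLoss_le θ F)) fun z => ?_
  by_cases hz : z ∈ {z : Vec n × ℝ | z.2 * F z.1 ≤ 0}
  · rw [Set.indicator_of_mem hz]
    exact (ramp_of_nonpos hθ (clip_mul_nonpos hz)).ge
  · rw [Set.indicator_of_notMem hz]
    exact ramp_nonneg _ _

theorem empMean_rampLoss_le_marginFraction {n m : ℕ} {S : Sample n m}
    (hS : ∀ i, (S i).2 = 1 ∨ (S i).2 = -1) {θ : ℝ} (hθ : 0 < θ) (F : Vec n → ℝ) :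
    empMean (rampLoss θ F) S ≤ marginFraction S F θ := by
  classical
  refine div_le_div_of_nonneg_right ?_ (Nat.cast_nonneg m)
  have h : {i | (S i).2 * F (S i).1 ≤ θ} =
      ((Finset.univ.filter fun i => (S i).2 * F (S i).1 ≤ θ : Finset (Fin m)) : Set _) := by
    ext; simp
  rw [h, Set.ncard_coe_finset, Finset.card_filter]
  push_cast
  refine Finset.sum_le_sum fun i _ => ?_
  rw [rampLoss, clip_of_label (hS i)]
  split_ifs with hi
  · exact ramp_le_one _ _
  · exact (ramp_of_le hθ (not_le.1 hi).le).le

/-! ### The generalization bound -/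

/-- Dominated convergence along the compact-open topology; this permits the passage to a dense
sequence. -/
theorem continuous_integral_rampLoss_sub {n m : ℕ} (D : Measure (Vec n × ℝ))
    [IsProbabilityMeasure D] (θ : ℝ) (S : Sample n m) :
    Continuous fun F : C(Vec n, ℝ) => ∫ z, rampLoss θ F z ∂D - empMean (rampLoss θ F) S := by
  have hev : ∀ z, Continuous fun F : C(Vec n, ℝ) => rampLoss θ F z := fun z =>
    (continuous_ramp θ).comp (continuous_const.mul (continuous_eval_const z.1))
  refine Continuous.sub ?_ ((continuous_finsetSum _ fun i _ => hev (S i)).div_const _)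
  exact continuous_of_dominated (bound := fun _ => 1)
    (fun F => (continuous_rampLoss θ F.continuous).aestronglyMeasurable)
    (fun F => Filter.Eventually.of_forall (abs_rampLoss_le θ F)) (integrable_const 1)
    (Filter.Eventually.of_forall hev)

/-- Uniform deviation of the ramp loss over the class of residual networks. -/
theorem measure_exists_networkClass_dev_le {n m : ℕ} (hm : 0 < m) {σ : ℝ → ℝ}
    (hσ : LipschitzWith 1 σ) (hσ0 : σ 0 = 0) {Λ : ℕ → ℝ} (hΛ : ∀ t, 0 ≤ Λ t) (T : ℕ)
    (D : Measure (Vec n × ℝ)) [IsProbabilityMeasure D]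
    (hint : Integrable (fun S : Sample n m => maxInput S) (sampleLaw m D))
    {C θ : ℝ} (hC : 0 ≤ C) (hθ : 0 < θ) {t : ℝ} (ht : 0 ≤ t) :
    sampleLaw m D {S | ∃ F ∈ networkClass σ Λ T C,
      4 * C * rInf m D / θ * √(Real.log (2 * n) / (2 * m)) *
        ∑ t ∈ Finset.range (T + 1), weightProd Λ t + t <
        ∫ z, rampLoss θ F z ∂D - empMean (rampLoss θ F) S} ≤
      ENNReal.ofReal (Real.exp (-(2 * m * t ^ 2))) := by
  have hm' : (0 : ℝ) < m := by exact_mod_cast hm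
  let G : Set C(Vec n, ℝ) := {F | (F : Vec n → ℝ) ∈ networkClass σ Λ T C}
  have hne : Nonempty G := by
    have hmem : (fun x : Vec n => ∑ t ∈ Finset.range (T + 1), ∑ j, (0 : Vec n) j * (0 : ℝ)) ∈
        networkClass σ Λ T C :=
      ⟨0, fun _ _ _ => 0, by simpa [l1norm] using hC, fun t _ => zero_mem_neuronClass σ hΛ t, rfl⟩
    exact ⟨⟨⟨_, continuous_of_mem_networkClass hσ.continuous hmem⟩, hmem⟩⟩
  let d : ℕ → G := TopologicalSpace.denseSeq G
  set Q := √(Real.log (2 * n) / (2 * m))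
  set W := ∑ t ∈ Finset.range (T + 1), weightProd Λ t
  let K : Sample n m → ℝ := fun S => 1 / θ * (2 * C * (2 ^ m * m * maxInput S * Q * W))
  have hKeq : K = fun S => (1 / θ * (2 * C * (2 ^ m * m * Q * W))) * maxInput S := by
    funext S
    simp only [K]
    ring
  have hKi : Integrable K (sampleLaw m D) := hKeq ▸ hint.const_mul _
  have hK : ∀ S : Sample n m, RadBound (fun k i => rampLoss θ (d k).1 (S i)) (K S) := fun S =>
    ((radBound_networkClass hm hσ hσ0 hΛ S T hC).comp
      fun k => (⟨_, (d k).2⟩ : networkClass σ Λ T C)).rampLoss hθ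
  -- One factor `2` comes from symmetrization, the other from the final linear classifier.
  have hκ : 2 * (∫ S, K S ∂(sampleLaw m D)) / m / 2 ^ m = 4 * C * rInf m D / θ * Q * W := by
    rw [hKeq, integral_const_mul, ← rInf]
    field_simp
    ring
  refine (measure_mono ?_).trans (measure_exists_dev_le hm D
    (fun k => (continuous_rampLoss θ (d k).1.continuous).measurable)
    (fun k z => ramp_nonneg _ _) (fun k z => ramp_le_one _ _) hKi hK ht)
  rintro S ⟨F, hF, hlt⟩
  change ∃ k, 2 * (∫ S, K S ∂(sampleLaw m D)) / m / 2 ^ m + t < _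
  rw [hκ]
  -- A strict violation is an open condition, so some member of the dense sequence violates the
  -- bound as well.
  have hcont := (continuous_integral_rampLoss_sub D θ S).comp 
    (continuous_subtype_val : Continuous (Subtype.val : G → C(Vec n, ℝ)))
  obtain ⟨k, hk⟩ := (TopologicalSpace.denseRange_denseSeq G).exists_mem_open
    (isOpen_Ioi.preimage hcont)
    ⟨(⟨⟨F, continuous_of_mem_networkClass hσ.continuous hF⟩, hF⟩ : G), hlt⟩
  exact ⟨k, hk⟩

/-- The confidence term dominates the deviation in McDiarmid's inequality unless the bound is
trivial. -/
theorem le_betaTerm_or_one_le {θ : ℝ} (hθ : 0 < θ) {m T : ℕ} (hm : 0 < m) (hT : 2 ≤ T) (δ : ℝ) :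
    √(Real.log (2 / δ) / (2 * m)) ≤ betaTerm θ m T δ ∨ 1 ≤ 2 / θ * √(Real.log T / m) := by
  have hm' : (0 : ℝ) < m := by exact_mod_cast hm
  have hlog : 0 < Real.log T := Real.log_pos (by exact_mod_cast hT)
  rcases le_or_gt (Real.log T) (θ ^ 2 * m) with h | h
  · left
    refine Real.sqrt_le_sqrt (le_add_of_nonneg_left (mul_nonneg ?_ (by positivity)))
    have : 0 ≤ Real.log (θ ^ 2 * m / Real.log T) :=
      Real.log_nonneg ((one_le_div hlog).2 h)
    exact_mod_cast Int.ceil_nonneg (by positivity)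
  · right
    have : θ ≤ √(Real.log T / m) :=
      Real.le_sqrt_of_sq_le ((le_div_iff₀ hm').2 h.le)
    rw [div_mul_eq_mul_div, le_div_iff₀ hθ]
    linarith

end BoostResNet

theorem mainTheorem3 {n m : ℕ} (hm : 0 < m) (T : ℕ)
    (σ : ℝ → ℝ) (hσ : LipschitzWith 1 σ) (hσ0 : σ 0 = 0)
    (Λ : ℕ → ℝ) (hΛ : ∀ t, 0 ≤ Λ t) (η : ℝ) (hη : 0 ≤ η) (γ : ℝ) (hγ : 0 < γ) :
    -- margins on the training sample
    (∀ (S : BoostResNet.Sample n m), (∀ i, (S i).2 = 1 ∨ (S i).2 = -1) →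
      ∀ (f : ℕ → BoostResNet.Vec n → BoostResNet.Vec n) (w : ℕ → BoostResNet.Vec n) (α : ℕ → ℝ),
        BoostResNet.IsRun σ Λ η T S f w α → BoostResNet.WeakLearning γ T S f w α →
        ∀ θ : ℝ, BoostResNet.marginFraction S (BoostResNet.network f w T) θ ≤
          BoostResNet.marginBound γ T (BoostResNet.edge S f w α (T + 1)) θ) ∧
    -- generalization error
    (2 ≤ T → ∀ (D : MeasureTheory.Measure (BoostResNet.Vec n × ℝ)),
      MeasureTheory.IsProbabilityMeasure D →
      (∀ᵐ z ∂D, z.2 = 1 ∨ z.2 = -1) →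
      MeasureTheory.Integrable (fun S : BoostResNet.Sample n m => BoostResNet.maxInput S)
        (BoostResNet.sampleLaw m D) →
      ∀ (C₀ θ δ : ℝ), 0 < θ → 0 < δ → δ < 1 →
        BoostResNet.sampleLaw m D {S | ¬ ∀ (f : ℕ → BoostResNet.Vec n → BoostResNet.Vec n)
          (w : ℕ → BoostResNet.Vec n) (α : ℕ → ℝ),
          BoostResNet.IsRun σ Λ η T S f w α → BoostResNet.WeakLearning γ T S f w α →
          BoostResNet.l1norm (w (T + 1)) ≤ C₀ →
          D.real {z | z.2 * BoostResNet.network f w T z.1 ≤ 0} ≤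
            BoostResNet.marginBound γ T (BoostResNet.edge S f w α (T + 1)) θ
            + 4 * C₀ * BoostResNet.rInf m D / θ * √(Real.log (2 * n) / (2 * m)) *
                ∑ t ∈ Finset.range (T + 1), BoostResNet.weightProd Λ t
            + 2 / θ * √(Real.log T / m)
            + BoostResNet.betaTerm θ m T δ}
          ≤ ENNReal.ofReal δ) := by
  refine ⟨fun S hS f w α hr hw θ =>
    BoostResNet.marginFraction_le_marginBound hm hS hr hw θ, ?_⟩
  intro hT D hD hlab hint C₀ θ δ hθ hδ hδ1
  have hm' : (0 : ℝ) < m := by exact_mod_cast hm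
  -- For negative `C₀` no run qualifies and the bad event is empty.
  rcases lt_or_ge C₀ 0 with hC | hC
  · have hpos : ∀ u : BoostResNet.Vec n, 0 ≤ BoostResNet.l1norm u := fun u =>
      Finset.sum_nonneg fun _ _ => abs_nonneg _
    refine (measure_mono_null ?_ measure_empty).le.trans zero_le
    intro S hS
    exact hS fun f w α _ _ hw => absurd (hw.trans_lt hC) (not_lt.2 (hpos _))
  have hlog : 0 < Real.log (2 / δ) := Real.log_pos ((one_lt_div hδ).2 (by linarith))
  set t := √(Real.log (2 / δ) / (2 * m)) with ht
  -- The left side equals `δ / 2`.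
  have hexp : Real.exp (-(2 * m * t ^ 2)) ≤ δ := by
    rw [ht, Real.sq_sqrt (by positivity), mul_div_cancel₀ _ (by positivity), Real.exp_neg,
      Real.exp_log (by positivity), inv_div]
    linarith
  have hlabS : ∀ᵐ S ∂(BoostResNet.sampleLaw m D), ∀ i : Fin m, (S i).2 = 1 ∨ (S i).2 = -1 :=
    ae_all_iff.2 fun i =>
      (Measure.tendsto_eval_ae_ae (μ := fun _ : Fin m => D) (i := i)).eventually hlab
  refine le_trans (measure_mono_ae ?_) ((BoostResNet.measure_exists_networkClass_dev_le hm hσ hσ0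
    hΛ T D hint hC hθ (Real.sqrt_nonneg (Real.log (2 / δ) / (2 * m)))).trans
      (ENNReal.ofReal_le_ofReal hexp))
  filter_upwards [hlabS] with S hS hbad
  by_contra hgood
  refine hbad fun f w α hr hw hwC => ?_
  have hF := BoostResNet.network_mem_networkClass hΛ hr hwC
  have hmargin := BoostResNet.marginFraction_le_marginBound hm hS hr hw θ
  have hemp := BoostResNet.empMean_rampLoss_le_marginFraction hS hθ (BoostResNet.network f w T)
  have herr := BoostResNet.measureReal_nonpos_le_integral_rampLoss D hθ
    (BoostResNet.continuous_of_mem_networkClass hσ.continuous hF)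
  have hdev := not_lt.1 fun h => hgood ⟨_, hF, h⟩
  have hR : 0 ≤ 2 / θ * √(Real.log T / m) := by positivity
  -- Either the confidence term absorbs the deviation `t`, and the `√(log T / m)` term is only
  -- slack, or that term alone is at least `1` and the bound on a probability is trivial.
  rcases BoostResNet.le_betaTerm_or_one_le hθ hm hT δ with hβ | h1
  · linarith
  · have hM : 0 ≤ BoostResNet.marginFraction S (BoostResNet.network f w T) θ :=
      div_nonneg (Nat.cast_nonneg _) hm'.le
    have hβ : 0 ≤ BoostResNet.betaTerm θ m T δ := Real.sqrt_nonneg _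
    have hr0 : 0 ≤ BoostResNet.rInf m D := integral_nonneg BoostResNet.maxInput_nonneg
    have hW : 0 ≤ ∑ t ∈ Finset.range (T + 1), BoostResNet.weightProd Λ t :=
      Finset.sum_nonneg fun t _ => BoostResNet.weightProd_nonneg hΛ t
    have hC' : 0 ≤ 4 * C₀ * BoostResNet.rInf m D / θ * √(Real.log (2 * n) / (2 * m)) *
        ∑ t ∈ Finset.range (T + 1), BoostResNet.weightProd Λ t := by positivity
    have hle : D.real {z | z.2 * BoostResNet.network f w T z.1 ≤ 0} ≤ 1 := measureReal_le_one
    linarith
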